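/- Let $n\ge 2$, let $G=\langle x\rangle$ be a cyclic group of order $2^n$, let $\alpha$ be a primitive $2^n$-th root of unity (for instance $\alpha=e^{2\pi i/2^n}$), let $K=\mathbb{Q}(\alpha)$, whose ring of integers is $\mathbb{Z}[\alpha]$, and let $\chi_1$ be the character of $G$ with $\chi_1(x)=\alpha$. Let $V(\mathbb{Z}G)$ be the group of units of augmentation $1$ of $\mathbb{Z}G$. For $\beta\in K$ put $$u_{\chi_1}(\beta)=1+\sum_{\sigma\in\mathrm{Gal}(K/\mathbb{Q})}(\sigma(\beta)-1)\,e(\sigma\circ\chi_1),\qquad e(\psi)=\frac1{|G|}\sum_{g\in G}\psi(g^{-1})\,g,$$ an element of $KG\supseteq\mathbb{Z}G$. Let $$W_1=\langle u_{\chi_1}(\beta)\in V(\mathbb{Z}G)\mid \beta\in\mathbb{Z}[\alpha]^\times\rangle .$$ Let $P\le K^\times$ be the subgroup generated by all $1-\alpha^k$, $1\le k\le 2^n-1$, let $K(\alpha)=P\cap\mathbb{Z}[\alpha]^\times$ be the group of circular units, and let $$W_1^{\mathrm{circ}}=\langle u_{\chi_1}(\beta)\in V(\mathbb{Z}G)\mid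 \beta\in K(\alpha)\rangle\le W_1$$ be the part of $W_1$ that comes from circular units. Let $D$ be the subgroup of $\mathbb{Z}[\alpha]^\times$ generated by $d_1,d_3,\dots,d_{2^{n-1}-3}$, that is, by the elements $d_{2l+1}$ with $0\le l\le 2^{n-2}-2$, where $d_j=1+\alpha^j+\alpha^{-j}$ (so $D$ is trivial for $n=2$). Finally let $E=(1+2\mathbb{Z}[\alpha])\cap D$ and $V_1=\{u_{\chi_1}(\lambda)\in W_1\mid\lambda\in E\}$. Then: 1. $V_1$ is a subgroup of $W_1$. 2. $W_1^{\mathrm{circ}}=\langle x^{2^{n-1}}\rangle\times V_1$ (internal direct product). In particular, whenever all units of $\mathbb{Z}[\alpha]$ are circular, that is, $\mathbb{Z}[\alpha]^\times=K(\alpha)$, one has $W_1=\langle x^{2^{n-1}}\rangle\times V_1$. -/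

import Mathlib

open scoped NumberField

noncomputable section

namespace CyclicTwoGroupUnits

section GroupRing

variable {G : Type*} [CommGroup G] {K : Type*} [Field K]

/-- The inclusion `ℤG → KG` (coefficientwise). -/
def coeffMap (G : Type*) [CommGroup G] (K : Type*) [Field K] :
    MonoidAlgebra ℤ G →+* MonoidAlgebra K G :=
  MonoidAlgebra.mapRingHom G (Int.castRingHom K)

/-- The augmentation `ℤG → ℤ`, sending every `g ∈ G` to `1`. -/
def augmentation (G : Type*) [CommGroup G] : MonoidAlgebra ℤ G →+* ℤ :=
  (MonoidAlgebra.lift ℤ ℤ G (1 : G →* ℤ)).toRingHom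

/-- The normalized unit group `V(ℤG)`: the units of `ℤG` of augmentation `1`. -/
def normalizedUnits (G : Type*) [CommGroup G] : Subgroup (MonoidAlgebra ℤ G)ˣ :=
  (Units.map (augmentation G).toMonoidHom).ker

/-- An element of `G` viewed as a unit of `ℤG`. -/
def groupUnit (g : G) : (MonoidAlgebra ℤ G)ˣ :=
  Units.map (MonoidAlgebra.of ℤ G) (toUnits g)

variable [Fintype G]

/-- The primitive idempotent `e(χ) = |G|⁻¹ ∑_g χ(g⁻¹) g` of a linear character `χ`. -/
def charIdempotent (χ : G →* Kˣ) : MonoidAlgebra K G :=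
  ∑ g : G, MonoidAlgebra.single g ((Fintype.card G : K)⁻¹ * (χ g⁻¹ : K))

variable [NumberField K]

/-- For a linear character `χ` whose values generate the field `K = ℚ(χ)` over `ℚ` (which is then
Galois over `ℚ`), and for `β ∈ K`, the element
`u_χ(β) = 1 + ∑_{σ ∈ Gal(K/ℚ)} (σ β - 1) e(σ ∘ χ)`. -/
def localUnit (χ : G →* Kˣ) (β : K) : MonoidAlgebra K G :=
  1 + ∑ σ : K ≃ₐ[ℚ] K,
    (σ β - 1) • charIdempotent ((Units.map (σ : K →* K)).comp χ)

/-- The subgroup of `V(ℤG)` generated by the elements `u_χ(β)` that lie in `V(ℤG)`, where `β`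
runs through a given group `U` of units of the ring of integers of `K = ℚ(χ)`. -/
def localUnitGroup (χ : G →* Kˣ) (U : Subgroup (𝓞 K)ˣ) : Subgroup (MonoidAlgebra ℤ G)ˣ :=
  Subgroup.closure {v | v ∈ normalizedUnits G ∧
    ∃ β ∈ U, coeffMap G K v = localUnit χ ((β : 𝓞 K) : K)}

end GroupRing

section Circular

variable {K : Type*} [Field K]

/-- The group `P ≤ Kˣ` generated by the `1 - α ^ k`, `1 ≤ k ≤ 2 ^ n - 1`. -/
def oneSubPowGroup (n : ℕ) (α : K) : Subgroup Kˣ :=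
  Subgroup.closure {w | ∃ k ∈ Finset.Icc 1 (2 ^ n - 1), (w : K) = 1 - α ^ k}

/-- The group `K(α)` of circular units: the units of the ring of integers that lie in `P`. -/
def circularUnits (n : ℕ) (α : K) : Subgroup (𝓞 K)ˣ :=
  (oneSubPowGroup n α).comap (Units.map (algebraMap (𝓞 K) K).toMonoidHom)

/-- `d_j = 1 + α ^ j + α ^ (-j)`. -/
def dElt (α : K) (j : ℤ) : K := 1 + α ^ j + α ^ (-j)

/-- The group `D` generated by `d_1, d_3, …, d_{2^(n-1) - 3}`, that is, by the `d_{2l+1}` with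
`0 ≤ l ≤ 2^(n-2) - 2`. -/
def groupD (n : ℕ) (α : K) : Subgroup (𝓞 K)ˣ :=
  Subgroup.closure {w | ∃ l ∈ Finset.range (2 ^ (n - 2) - 1),
    ((w : 𝓞 K) : K) = dElt α (2 * (l : ℤ) + 1)}

/-- `E = (1 + 2 ℤ[α]) ∩ D`. -/
def setE (n : ℕ) (α : K) : Set (𝓞 K)ˣ :=
  {w | w ∈ groupD n α ∧ ∃ ρ ∈ Algebra.adjoin ℤ {α}, ((w : 𝓞 K) : K) = 1 + 2 * ρ}

end Circular

section Main

variable {G : Type*} [CommGroup G] [Fintype G] {K : Type*} [Field K] [NumberField K]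

/-- `W₁`: the subgroup of `V(ℤG)` generated by the `u_χ(β) ∈ V(ℤG)`, for all units `β` of the
ring of integers of `ℚ(χ)`. -/
def groupW (χ : G →* Kˣ) : Subgroup (MonoidAlgebra ℤ G)ˣ :=
  localUnitGroup χ ⊤

/-- The part of `W₁` that comes from circular units: the subgroup of `V(ℤG)` generated by
the `u_χ(β) ∈ V(ℤG)` with `β` a circular unit. -/
def groupWCirc (n : ℕ) (α : K) (χ : G →* Kˣ) : Subgroup (MonoidAlgebra ℤ G)ˣ :=
  localUnitGroup χ (circularUnits n α)

/-- `V₁ = {u_χ(λ) ∈ W₁ | λ ∈ E}`. -/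
def setV (n : ℕ) (α : K) (χ : G →* Kˣ) : Set (MonoidAlgebra ℤ G)ˣ :=
  {v | v ∈ groupW χ ∧ ∃ w ∈ setE n α, coeffMap G K v = localUnit χ ((w : 𝓞 K) : K)}

/-- `A` is the internal direct product of its subgroups `B` and `C`, all inside a commutative
group. -/
def IsInternalProd {M : Type*} [CommGroup M] (A B C : Subgroup M) : Prop :=
  B ⊓ C = ⊥ ∧ B ⊔ C = A

end Main

end CyclicTwoGroupUnits

end

namespace CyclicTwoGroupUnits

/-! ### Powers of 3 modulo `2 ^ n`. -/

section Arithmetic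

/-! The map `β ↦ u_χ(β)` is multiplicative, and evaluation at `χ` is a left inverse of it. So a
group generated by integral `u_χ(β)`, with `β` in a unit group `U`, just consists of the integral
`u_χ(β)` (`mem_localUnitGroup`), and questions about `W₁` become questions about units. Integrality
of `u_χ(β)` forces `β ≡ 1` modulo `2ℤ[α]` (`exists_eq_one_add_two_mul`), so `V₁` is the group
attached to all of `D`. Moreover `u_χ(-1)` is the involution `x ^ 2 ^ (n - 1)`.

For generation, write a circular unit as `β = α ^ k * d` with `d ∈ D`
(`exists_eq_of_mem_circularUnits`). As `d` is real and `β ≡ 1` modulo 2, comparing the traces of `β`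
and its complex conjugate gives `α ^ k = ±1` (`zpow_sq_eq_one_of_congr`), so `β = ±d`.

For trivial intersection one needs `-1 ∉ D` (`neg_one_notMem_groupD`). For `n ≥ 3` the elements
`d_{3^k}`, `k` modulo `2 ^ (n - 2)`, are permuted cyclically by the Galois group and have product
`-1`; `D` is generated by all but one of them. If `-1` were a product of powers `d_{3^k} ^ m_k` with
one `m_k` zero, the signs of all its conjugates would give a convolution equation over `𝔽₂`. The
sign vector has augmentation 1, hence is invertible in the group algebra of a cyclic 2-group, and
this forces every `m_k` to be odd. -/

theorem three_pow_two_pow (k : ℕ) :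
    ∃ c : ℤ, Odd c ∧ (3 : ℤ) ^ 2 ^ (k + 1) = 1 + 2 ^ (k + 3) * c := by
  induction k with
  | zero => exact ⟨1, by decide, by norm_num⟩
  | succ k ih =>
    obtain ⟨c, hc, h⟩ := ih
    refine ⟨c + 2 ^ (k + 2) * c ^ 2, ?_, ?_⟩
    · refine hc.add_even (Even.mul_right ?_ _)
      exact (even_two (α := ℤ)).pow_of_ne_zero (by omega)
    · rw [pow_succ 2 (k + 1), pow_mul, h]
      ring

/-- Lifting from `2 ^ n` to `2 ^ (n + 1)`: if the quotient `b` is odd, adding `2 ^ (n - 2)` to the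
exponent changes the power of 3 by an odd multiple of `2 ^ n`, which corrects the parity. -/
theorem odd_eq_three_pow (n : ℕ) (a : ℤ) (ha : Odd a) :
    ∃ k : ℕ, (2 : ℤ) ^ n ∣ a - 3 ^ k ∨ (2 : ℤ) ^ n ∣ a + 3 ^ k := by
  rcases Nat.lt_or_ge n 3 with hn | hn
  · refine ⟨0, ?_⟩
    have h4 : (4 : ℤ) ∣ a - 3 ^ 0 ∨ (4 : ℤ) ∣ a + 3 ^ 0 := by
      obtain ⟨b, rfl⟩ := ha
      simp only [pow_zero]
      omega
    have h2 : (2 : ℤ) ^ n ∣ 4 := by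
      have := pow_dvd_pow (2 : ℤ) (show n ≤ 2 by omega)
      norm_num at this
      exact this
    exact h4.imp h2.trans h2.trans
  · induction n, hn using Nat.le_induction with
    | base =>
      obtain ⟨b, rfl⟩ := ha
      by_cases hb : b % 4 = 0 ∨ b % 4 = 3
      · exact ⟨0, by norm_num; omega⟩
      · exact ⟨1, by norm_num; omega⟩
    | succ n hn ih =>
      obtain ⟨k, hk⟩ := ih
      obtain ⟨j, rfl⟩ : ∃ j, n = j + 3 := ⟨n - 3, by omega⟩
      obtain ⟨c, hc, h3⟩ := three_pow_two_pow j
      have h3k : Odd ((3 : ℤ) ^ k) := Odd.pow (by decide)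
      obtain ⟨e, he⟩ := hc.mul h3k
      rcases hk with ⟨b, hb⟩ | ⟨b, hb⟩
      · rcases Int.even_or_odd b with ⟨d, hd⟩ | ⟨d, hd⟩
        · exact ⟨k, Or.inl ⟨d, by rw [hb, hd]; ring⟩⟩
        · refine ⟨k + 2 ^ (j + 1), Or.inl ⟨d - e, ?_⟩⟩
          rw [pow_add, h3, show a = 3 ^ k + 2 ^ (j + 3) * b by linarith, hd]
          linear_combination (-(2 : ℤ) ^ (j + 3)) * he
      · rcases Int.even_or_odd b with ⟨d, hd⟩ | ⟨d, hd⟩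
        · exact ⟨k, Or.inr ⟨d, by rw [hb, hd]; ring⟩⟩
        · refine ⟨k + 2 ^ (j + 1), Or.inr ⟨d + e + 1, ?_⟩⟩
          rw [pow_add, h3, show a = -3 ^ k + 2 ^ (j + 3) * b by linarith, hd]
          linear_combination ((2 : ℤ) ^ (j + 3)) * he

theorem three_pow_two_pow_sub_two (n : ℕ) (hn : 2 ≤ n) :
    (2 : ℤ) ^ n ∣ 3 ^ 2 ^ (n - 2) - 1 ∨ (2 : ℤ) ^ n ∣ 3 ^ 2 ^ (n - 2) + 1 := by
  obtain ⟨k, rfl⟩ := Nat.exists_eq_add_of_le' hn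
  rcases k with _ | k
  · right; norm_num
  · obtain ⟨c, -, h⟩ := three_pow_two_pow k
    left
    refine ⟨c, ?_⟩
    rw [show k + 1 + 2 - 2 = k + 1 by omega, h]; ring

/-- Every odd integer is congruent to some `±3 ^ k`, `k < 2 ^ (n - 2)`, modulo `2 ^ n`. -/
theorem odd_eq_three_pow_lt (n : ℕ) (hn : 2 ≤ n) (a : ℤ) (ha : Odd a) :
    ∃ k < 2 ^ (n - 2), (2 : ℤ) ^ n ∣ a - 3 ^ k ∨ (2 : ℤ) ^ n ∣ a + 3 ^ k := by
  obtain ⟨k, hk⟩ := odd_eq_three_pow n a ha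
  have key : ∀ q r : ℕ, ((2 : ℤ) ^ n ∣ a - 3 ^ (2 ^ (n - 2) * q + r) ∨
      (2 : ℤ) ^ n ∣ a + 3 ^ (2 ^ (n - 2) * q + r)) →
      ((2 : ℤ) ^ n ∣ a - 3 ^ r ∨ (2 : ℤ) ^ n ∣ a + 3 ^ r) := by
    intro q
    induction q with
    | zero => intro r h; simpa using h
    | succ q ih =>
      intro r h
      apply ih
      rw [show 2 ^ (n - 2) * (q + 1) + r = 2 ^ (n - 2) + (2 ^ (n - 2) * q + r) by ring,
        pow_add] at h
      set y : ℤ := 3 ^ (2 ^ (n - 2) * q + r)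
      rcases h with ⟨b, hb⟩ | ⟨b, hb⟩ <;>
        rcases three_pow_two_pow_sub_two n hn with ⟨c, hc⟩ | ⟨c, hc⟩
      · exact Or.inl ⟨b + c * y, by linear_combination hb + y * hc⟩
      · exact Or.inr ⟨b + c * y, by linear_combination hb + y * hc⟩
      · exact Or.inr ⟨b - c * y, by linear_combination hb - y * hc⟩
      · exact Or.inl ⟨b - c * y, by linear_combination hb - y * hc⟩
  refine ⟨k % 2 ^ (n - 2), Nat.mod_lt _ (by positivity), key (k / 2 ^ (n - 2)) _ ?_⟩
  rwa [Nat.div_add_mod]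

end Arithmetic

/-! ### Invertibility in the group algebra over `𝔽₂`. -/

section Convolution

/-- In the group algebra over `𝔽₂` of a cyclic group of order `2 ^ k`, an element of augmentation
one is invertible. -/
theorem eq_one_of_convolution_eq_one (k : ℕ) (s m : ZMod (2 ^ k) → ZMod 2)
    (hs : ∑ i, s i = 1) (h : ∀ t, ∑ i, m i * s (i + t) = 1) (i : ZMod (2 ^ k)) : m i = 1 := by
  have hchar : CharP (AddMonoidAlgebra (ZMod 2) (ZMod (2 ^ k))) 2 :=
    charP_of_injective_algebraMap
      (algebraMap (ZMod 2) (AddMonoidAlgebra (ZMod 2) (ZMod (2 ^ k)))).injective 2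
  have hsum : ∀ (t : ZMod (2 ^ k)) (f : ZMod (2 ^ k) → ZMod 2),
      ∑ i, AddMonoidAlgebra.single t (f i) = AddMonoidAlgebra.single t (∑ i, f i) := fun t f =>
    (map_sum (AddMonoidAlgebra.singleAddHom t) _ _).symm
  obtain ⟨S, hS⟩ : ∃ S : AddMonoidAlgebra (ZMod 2) (ZMod (2 ^ k)),
    S = ∑ i, AddMonoidAlgebra.single i (s i) := ⟨_, rfl⟩
  -- The inverted index `-i` makes the coefficient of `R * S` at `t` equal to `∑ i, m i * s (i +
  -- t)`.
  obtain ⟨R, hR⟩ : ∃ R : AddMonoidAlgebra (ZMod 2) (ZMod (2 ^ k)),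
    R = ∑ i, AddMonoidAlgebra.single (-i) (m i) := ⟨_, rfl⟩
  obtain ⟨T, hT⟩ : ∃ T : AddMonoidAlgebra (ZMod 2) (ZMod (2 ^ k)),
    T = ∑ i, AddMonoidAlgebra.single i 1 := ⟨_, rfl⟩
  -- Frobenius is additive, and `2 ^ k` kills the indexing group, so only the augmentation of `S`
  -- survives.
  have hpow : S ^ 2 ^ k = 1 := by
    rw [hS, sum_pow_char_pow 2 k]
    have h2 : ∀ i, AddMonoidAlgebra.single i (s i) ^ 2 ^ k = AddMonoidAlgebra.single 0 (s i) := by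
      intro i
      rw [AddMonoidAlgebra.single_pow, nsmul_eq_mul, ZMod.natCast_self, zero_mul, ZMod.pow_card_pow]
    rw [Finset.sum_congr rfl fun i _ => h2 i, hsum, hs]
    rfl
  have hRS : R * S = T := by
    rw [hR, hS, hT, Finset.sum_mul_sum]
    have h1 : ∀ i, ∑ j, AddMonoidAlgebra.single (-i) (m i) * AddMonoidAlgebra.single j (s j) =
        ∑ t, AddMonoidAlgebra.single t (m i * s (i + t)) := fun i =>
      Fintype.sum_equiv (Equiv.addLeft (-i)) _ _ fun j => by
        simp [AddMonoidAlgebra.single_mul_single]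
    rw [Finset.sum_congr rfl fun i _ => h1 i, Finset.sum_comm]
    exact Finset.sum_congr rfl fun t _ => by rw [hsum, h t]
  have hTS : T * S = T := by
    rw [hS, hT, Finset.sum_mul_sum, Finset.sum_comm]
    have h1 : ∀ i, ∑ j, AddMonoidAlgebra.single j 1 * AddMonoidAlgebra.single i (s i) =
        ∑ t, AddMonoidAlgebra.single t (s i) := fun i =>
      Fintype.sum_equiv (Equiv.addRight i) _ _ fun j => by
        simp [AddMonoidAlgebra.single_mul_single]
    rw [Finset.sum_congr rfl fun i _ => h1 i, Finset.sum_comm]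
    exact Finset.sum_congr rfl fun t _ => by rw [hsum, hs]
  -- Since `T` absorbs `S`, multiplying by further powers of `S` keeps `T`; the power `S ^ 2 ^ k =
  -- 1` then yields `R = T`.
  have hTp : ∀ j, R * S ^ (j + 1) = T := by
    intro j
    induction j with
    | zero => rw [zero_add, pow_one, hRS]
    | succ j ih => rw [pow_succ, ← mul_assoc, ih, hTS]
  have hRT : R = T := by
    obtain ⟨j, hj⟩ : ∃ j, 2 ^ k = j + 1 :=
      Nat.exists_eq_succ_of_ne_zero (pow_ne_zero k (two_ne_zero (α := ℕ)))
    have h1 : S ^ (j + 1) = 1 := hj ▸ hpow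
    rw [← hTp j, h1, mul_one]
  have hc := congrArg (fun f => f.coeff (-i)) hRT
  simpa [hR, hT, AddMonoidAlgebra.coeff_sum, Finsupp.finsetSum_apply,
    Finsupp.single_apply] using hc

end Convolution

/-! ### Signs of real numbers in `𝔽₂`. -/

section Sign

/-- The sign of a nonzero real number as an element of `𝔽₂`. -/
noncomputable def signHom : ℝˣ →* Multiplicative (ZMod 2) where
  toFun r := Multiplicative.ofAdd (if (r : ℝ) < 0 then 1 else 0)
  map_one' := by simp
  map_mul' a b := by
    rw [← ofAdd_add]
    congr 1
    rcases lt_or_gt_of_ne a.ne_zero with ha | ha <;> rcases lt_or_gt_of_ne b.ne_zero with hb | hb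
    · simp [ha, hb, (mul_pos_of_neg_of_neg ha hb).not_gt]; decide
    · simp [ha, hb.not_gt, mul_neg_of_neg_of_pos ha hb]
    · simp [ha.not_gt, hb, mul_neg_of_pos_of_neg ha hb]
    · simp [ha.not_gt, hb.not_gt, (mul_pos ha hb).not_gt]

theorem signHom_neg_one : signHom (-1) = Multiplicative.ofAdd 1 := by
  simp [signHom]

end Sign

/-! ### Galois action and traces in the cyclotomic field. -/

section Field

variable {K : Type*} [Field K] {n : ℕ} {α : K}

theorem pow_two_pow_pred_eq_neg_one (hn : 1 ≤ n) (hα : IsPrimitiveRoot α (2 ^ n)) :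
    α ^ 2 ^ (n - 1) = -1 := by
  have h1 : α ^ 2 ^ (n - 1) ≠ 1 := hα.pow_ne_one_of_pos_of_lt (by positivity)
    (Nat.pow_lt_pow_right one_lt_two (by omega))
  have h2 : (α ^ 2 ^ (n - 1)) ^ 2 = 1 := by
    rw [← pow_mul, ← pow_succ, Nat.sub_add_cancel hn, hα.pow_eq_one]
  exact (eq_or_eq_neg_of_sq_eq_sq _ 1 (by rw [h2, one_pow])).resolve_left h1

theorem zpow_eq_of_dvd_sub (hα : IsPrimitiveRoot α (2 ^ n)) {a b : ℤ}
    (h : (2 : ℤ) ^ n ∣ a - b) : α ^ a = α ^ b := by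
  have h0 : α ≠ 0 := hα.ne_zero (by positivity)
  rw [← mul_inv_eq_one₀ (zpow_ne_zero _ h0), ← zpow_neg, ← zpow_add₀ h0, ← sub_eq_add_neg,
    hα.zpow_eq_one_iff_dvd]
  exact_mod_cast h

theorem zpow_eq_neg_one_of_odd (hn : 1 ≤ n) (hα : IsPrimitiveRoot α (2 ^ n)) {b : ℤ}
    (hb : Odd b) : α ^ (2 ^ (n - 1) * b) = -1 := by
  have h := pow_two_pow_pred_eq_neg_one hn hα
  have h2 : α ^ ((2 : ℤ) ^ (n - 1)) = -1 := by exact_mod_cast h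
  rw [zpow_mul, h2, hb.neg_one_zpow]

theorem zpow_mem_adjoin (hα : IsPrimitiveRoot α (2 ^ n)) (j : ℤ) :
    α ^ j ∈ Algebra.adjoin ℤ {α} := by
  have h : α ^ j = α ^ (j % 2 ^ n) :=
    zpow_eq_of_dvd_sub hα (Int.dvd_self_sub_emod)
  lift j % 2 ^ n to ℕ using Int.emod_nonneg _ (by positivity) with i
  rw [h, zpow_natCast]
  exact pow_mem (Algebra.self_mem_adjoin_singleton ℤ α) i

variable [NumberField K] [IsCyclotomicExtension {2 ^ n} ℚ K]

theorem exists_algEquiv_apply_eq_zpow (hα : IsPrimitiveRoot α (2 ^ n)) {t : ℤ} (ht : Odd t) :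
    ∃ σ : K ≃ₐ[ℚ] K, σ α = α ^ t := by
  have hirr := Polynomial.cyclotomic.irreducible_rat (n := 2 ^ n) (by positivity)
  have hμ : IsPrimitiveRoot (α ^ t) (2 ^ n) := hα.zpow_of_gcd_eq_one t (by
    rw [Int.gcd_comm, ← Int.isCoprime_iff_gcd_eq_one]
    push_cast
    exact IsCoprime.pow_left (Int.isCoprime_two_left.mpr ht))
  have h : minpoly ℚ (hα.powerBasis ℚ).gen = minpoly ℚ (hμ.powerBasis ℚ).gen := by
    rw [hα.powerBasis_gen ℚ, hμ.powerBasis_gen ℚ, ← hα.minpoly_eq_cyclotomic_of_irreducible hirr,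
      ← hμ.minpoly_eq_cyclotomic_of_irreducible hirr]
  refine ⟨(hα.powerBasis ℚ).equivOfMinpoly (hμ.powerBasis ℚ) h, ?_⟩
  have := (hα.powerBasis ℚ).equivOfMinpoly_gen (hμ.powerBasis ℚ) h
  rwa [hα.powerBasis_gen ℚ, hμ.powerBasis_gen ℚ] at this

/-- A power `ζ ≠ ±1` of `α` is Galois conjugate to `-ζ`. -/
theorem exists_algEquiv_apply_eq_neg (hα : IsPrimitiveRoot α (2 ^ n)) {ζ : K} {j : ℤ}
    (hj : α ^ j = ζ) (hζ : ζ ^ 2 ≠ 1) : ∃ σ : K ≃ₐ[ℚ] K, σ ζ = -ζ := by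
  have h0 : α ≠ 0 := hα.ne_zero (by positivity)
  have hj0 : j ≠ 0 := by rintro rfl; exact hζ (by rw [← hj]; simp)
  obtain ⟨a, b, hb, hab⟩ : ∃ a : ℕ, ∃ b : ℤ, Odd b ∧ j = 2 ^ a * b := by
    obtain ⟨b, h, hb⟩ := (Int.finiteMultiplicity_iff (a := 2).mpr ⟨by decide, hj0⟩).exists_eq_pow_mul_and_not_dvd
    exact ⟨_, b, Int.not_even_iff_odd.mp (mt Even.two_dvd hb), h⟩
  have ha : a + 2 ≤ n := by
    by_contra hlt
    apply hζ
    rw [← hj, ← zpow_natCast, ← zpow_mul, hα.zpow_eq_one_iff_dvd, hab]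
    have : (2 : ℤ) ^ n ∣ 2 ^ (a + 1) := pow_dvd_pow _ (by omega)
    push_cast
    rw [show (2 : ℤ) ^ a * b * 2 = 2 ^ (a + 1) * b by ring]
    exact this.mul_right b
  obtain ⟨c, rfl⟩ : ∃ c, n = a + 2 + c := ⟨n - (a + 2), by omega⟩
  -- With `n = a + 2 + c`, the exponent `j * 2 ^ (c + 1)` is `2 ^ (n - 1)` times the odd number `b`,
  -- so the extra factor is `-1`.
  obtain ⟨σ, hσ⟩ := exists_algEquiv_apply_eq_zpow hα (t := 1 + 2 ^ (c + 1))
    (odd_one.add_even ((even_two (α := ℤ)).pow_of_ne_zero (by omega)))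
  refine ⟨σ, ?_⟩
  rw [← hj, map_zpow₀, hσ, ← zpow_mul, add_mul, one_mul, zpow_add₀ h0, hab,
    show (2 : ℤ) ^ (c + 1) * (2 ^ a * b) = 2 ^ (a + 2 + c - 1) * b by
      rw [show a + 2 + c - 1 = a + (c + 1) by omega]; ring,
    zpow_eq_neg_one_of_odd (by omega) hα hb, mul_neg_one]

/-- Reindexing by an automorphism that negates `α ^ j` shows that the sum equals its own negative.
-/
theorem sum_algEquiv_zpow_eq_zero (hα : IsPrimitiveRoot α (2 ^ n)) {j : ℤ}
    (hj : (α ^ j) ^ 2 ≠ 1) : ∑ σ : K ≃ₐ[ℚ] K, σ (α ^ j) = 0 := by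
  obtain ⟨τ, hτ⟩ := exists_algEquiv_apply_eq_neg hα rfl hj
  have h : ∑ σ : K ≃ₐ[ℚ] K, σ (α ^ j) = ∑ σ : K ≃ₐ[ℚ] K, σ (-α ^ j) := by
    rw [← hτ]
    exact (Fintype.sum_equiv (Equiv.mulRight τ) _ _ fun σ => rfl).symm
  simp only [map_neg, Finset.sum_neg_distrib] at h
  linear_combination h / 2

theorem card_algEquiv (hn : 1 ≤ n) : Fintype.card (K ≃ₐ[ℚ] K) = 2 ^ (n - 1) := by
  have hirr := Polynomial.cyclotomic.irreducible_rat (n := 2 ^ n) (by positivity)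
  have := IsCyclotomicExtension.isGalois {2 ^ n} ℚ K
  rw [← Nat.card_eq_fintype_card, IsGalois.card_aut_eq_finrank,
    IsCyclotomicExtension.finrank (n := 2 ^ n) K hirr, Nat.totient_prime_pow Nat.prime_two hn]
  simp

theorem sum_algEquiv_zpow (hn : 1 ≤ n) (hα : IsPrimitiveRoot α (2 ^ n)) (j : ℤ) :
    ∃ t : ℤ, ∑ σ : K ≃ₐ[ℚ] K, σ (α ^ j) = 2 ^ (n - 1) * t := by
  by_cases hj : (α ^ j) ^ 2 = 1
  · rcases eq_or_eq_neg_of_sq_eq_sq (α ^ j) 1 (by rw [hj, one_pow]) with h | h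
    · exact ⟨1, by rw [h]; simp [card_algEquiv hn]⟩
    · exact ⟨-1, by rw [h]; simp [card_algEquiv hn]⟩
  · exact ⟨0, by rw [sum_algEquiv_zpow_eq_zero hα hj]; simp⟩

/-- The trace of an element of `ℤ[α]` is divisible by `2 ^ (n - 1)`. -/
theorem sum_algEquiv_of_mem_adjoin (hn : 1 ≤ n) (hα : IsPrimitiveRoot α (2 ^ n)) {z : K}
    (hz : z ∈ Algebra.adjoin ℤ {α}) :
    ∃ t : ℤ, ∑ σ : K ≃ₐ[ℚ] K, σ z = 2 ^ (n - 1) * t := by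
  rw [Algebra.adjoin_singleton_eq_range_aeval] at hz
  obtain ⟨f, rfl⟩ := hz
  induction f using Polynomial.induction_on' with
  | add p q hp hq =>
    obtain ⟨s, hs⟩ := hp
    obtain ⟨t, ht⟩ := hq
    exact ⟨s + t, by simp only [map_add, Finset.sum_add_distrib]; simp_all; ring⟩
  | monomial i a =>
    obtain ⟨t, ht⟩ := sum_algEquiv_zpow hn hα i
    refine ⟨a * t, ?_⟩
    simp only [zpow_natCast] at ht
    change ∑ σ : K ≃ₐ[ℚ] K, σ (Polynomial.aeval α (Polynomial.monomial i a)) = _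
    simp only [Polynomial.aeval_monomial, map_mul, eq_intCast, map_intCast,
      ← Finset.mul_sum, ht]
    push_cast
    ring

/-- If `d` is fixed by complex conjugation and `α ^ k * d ≡ 1` modulo `2`, then
`α ^ k = ±1`. -/
theorem zpow_sq_eq_one_of_congr (hn : 1 ≤ n) (hα : IsPrimitiveRoot α (2 ^ n))
    {c : K ≃ₐ[ℚ] K} (hc : c α = α⁻¹) {d ρ : K} (hd : c d = d) {k : ℤ}
    (hρ : ρ ∈ Algebra.adjoin ℤ {α}) (h : α ^ k * d = 1 + 2 * ρ) : (α ^ k) ^ 2 = 1 := by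
  have h0 : α ≠ 0 := hα.ne_zero (by positivity)
  set T : K → K := fun z => ∑ σ : K ≃ₐ[ℚ] K, σ z with hT
  have hTadd : ∀ x y, T (x + y) = T x + T y := fun x y => by simp [hT, Finset.sum_add_distrib]
  have hT2 : ∀ y, T (2 * y) = 2 * T y := fun y => by rw [two_mul, hTadd, two_mul]
  have hTneg : ∀ y, T (-y) = - T y := fun y => by simp [hT]
  have hT1 : T 1 = 2 ^ (n - 1) := by simp [hT, card_algEquiv hn]
  have hTc : ∀ z, T (c z) = T z := fun z =>
    Fintype.sum_equiv (Equiv.mulRight c) _ _ fun σ => rfl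
  have hcan : ∀ s t : ℤ, (2 : K) ^ (n - 1) * s = 2 ^ (n - 1) * t → s = t := by
    intro s t h
    exact_mod_cast mul_left_cancel₀ (pow_ne_zero _ (two_ne_zero (α := K))) h
  obtain ⟨t, ht⟩ := sum_algEquiv_of_mem_adjoin hn hα hρ
  obtain ⟨s, hs⟩ := sum_algEquiv_of_mem_adjoin hn hα (mul_mem (zpow_mem_adjoin hα (-(2 * k))) hρ)
  change T _ = _ at ht hs
  -- The trace divided by `2 ^ (n - 1)` is odd. Conjugation multiplies `α ^ k * d` by `α ^ (-(2 *
  -- k))` and preserves the trace.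
  have hA : T (α ^ k * d) = 2 ^ (n - 1) * ((1 + 2 * t : ℤ) : K) := by
    rw [h, hTadd, hT1, hT2, ht]; push_cast; ring
  have hconj : c (α ^ k * d) = α ^ (-(2 * k)) * (α ^ k * d) := by
    rw [map_mul, map_zpow₀, hc, hd, inv_zpow', ← mul_assoc, ← zpow_add₀ h0]
    congr 2
    ring
  have hB : T (α ^ (-(2 * k)) * (α ^ k * d)) = 2 ^ (n - 1) * ((1 + 2 * t : ℤ) : K) := by
    rw [← hconj, hTc, hA]
  have hsq : α ^ (-(2 * k)) = ((α ^ k) ^ 2)⁻¹ := by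
    rw [zpow_neg, mul_comm, zpow_mul]; norm_cast
  by_contra hne
  -- If `α ^ (-(2 * k)) = -1`, an odd integer equals its negative. Otherwise `α ^ (-(2 * k))` has
  -- trace 0, and the same normalized trace becomes even.
  by_cases h4 : (α ^ (-(2 * k))) ^ 2 = 1
  · have h1 : α ^ (-(2 * k)) ≠ 1 := by rw [hsq]; simpa using hne
    rw [(eq_or_eq_neg_of_sq_eq_sq _ 1 (by rw [h4, one_pow])).resolve_left h1, neg_one_mul, hTneg, hA, ← mul_neg] at hB
    have := hcan (-(1 + 2 * t)) (1 + 2 * t) (by rw [← hB]; push_cast; rfl)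
    omega
  · have hz : T (α ^ (-(2 * k))) = 0 := sum_algEquiv_zpow_eq_zero hα h4
    rw [h, mul_add, mul_one, hTadd, hz, mul_left_comm, hT2, hs] at hB
    have := hcan (2 * s) (1 + 2 * t) (by rw [← hB]; push_cast; ring)
    omega

theorem exists_algEquiv_inv (hα : IsPrimitiveRoot α (2 ^ n)) : ∃ c : K ≃ₐ[ℚ] K, c α = α⁻¹ := by
  obtain ⟨c, hc⟩ := exists_algEquiv_apply_eq_zpow hα (t := -1) (by decide)
  exact ⟨c, by simpa using hc⟩

end Field

/-! ### The elements `d_j` and their product. -/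

section Elements

variable {K : Type*} [Field K] {n : ℕ} {α : K}

theorem dElt_neg (α : K) (j : ℤ) : dElt α (-j) = dElt α j := by
  simp only [dElt, neg_neg]; ring

theorem dElt_congr (hα : IsPrimitiveRoot α (2 ^ n)) {a b : ℤ}
    (h : (2 : ℤ) ^ n ∣ a - b ∨ (2 : ℤ) ^ n ∣ a + b) : dElt α a = dElt α b := by
  have key : ∀ {a b : ℤ}, (2 : ℤ) ^ n ∣ a - b → dElt α a = dElt α b := by
    intro a b h
    have h' : (2 : ℤ) ^ n ∣ -a - -b := by
      rw [show -a - -b = -(a - b) by ring]; exact h.neg_right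
    rw [dElt, dElt, zpow_eq_of_dvd_sub hα h, zpow_eq_of_dvd_sub hα h']
  rcases h with h | h
  · exact key h
  · rw [← dElt_neg α b]
    exact key (by rwa [sub_neg_eq_add])

/-- With `y = α ^ j` this is `(1 + y + y⁻¹) * y * (1 - y) = 1 - y ^ 3`: it makes `d_j` a quotient of
generators of `P` and lets products over powers of 3 telescope. -/
theorem dElt_mul (h0 : α ≠ 0) (j : ℤ) :
    dElt α j * α ^ j * (1 - α ^ j) = 1 - α ^ (3 * j) := by
  have hy : α ^ j ≠ 0 := zpow_ne_zero _ h0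
  rw [dElt, mul_comm 3 j, zpow_mul, zpow_neg]
  norm_cast
  field_simp
  ring

theorem zpow_ne_one_of_odd (hn : 1 ≤ n) (hα : IsPrimitiveRoot α (2 ^ n)) {j : ℤ} (hj : Odd j) :
    α ^ j ≠ 1 := by
  rw [Ne, hα.zpow_eq_one_iff_dvd]
  intro h
  have h2 : (2 : ℤ) ∣ j := (dvd_pow_self 2 (show n ≠ 0 by omega)).trans (by exact_mod_cast h)
  exact (Int.not_even_iff_odd.mpr hj) (even_iff_two_dvd.mpr h2)

theorem dElt_ne_zero (hn : 1 ≤ n) (hα : IsPrimitiveRoot α (2 ^ n)) {j : ℤ} (hj : Odd j) :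
    dElt α j ≠ 0 := by
  intro h
  have h1 := dElt_mul (hα.ne_zero (by positivity)) j
  rw [h, zero_mul, zero_mul] at h1
  exact zpow_ne_one_of_odd hn hα (Odd.mul (by decide : Odd (3 : ℤ)) hj) (sub_eq_zero.mp h1.symm).symm

theorem map_dElt {L : Type*} [Field L] {F : Type*} [FunLike F K L] [RingHomClass F K L]
    (σ : F) (j : ℤ) : σ (dElt α j) = dElt (σ α) j := by
  simp [dElt]

theorem dElt_zpow (α : K) (t j : ℤ) : dElt (α ^ t) j = dElt α (t * j) := by
  simp only [dElt, ← zpow_mul, mul_neg]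

theorem dElt_three_pow_mod (hn : 2 ≤ n) (hα : IsPrimitiveRoot α (2 ^ n)) (a : ℕ) :
    dElt α (3 ^ a) = dElt α (3 ^ (a % 2 ^ (n - 2))) := by
  have key : ∀ q r : ℕ, dElt α (3 ^ (2 ^ (n - 2) * q + r)) = dElt α (3 ^ r) := by
    intro q r
    induction q with
    | zero => simp
    | succ q ih =>
      rw [← ih]
      apply dElt_congr hα
      rw [show 2 ^ (n - 2) * (q + 1) + r = 2 ^ (n - 2) + (2 ^ (n - 2) * q + r) by ring, pow_add,
        ← sub_one_mul, ← add_one_mul]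
      exact (three_pow_two_pow_sub_two n hn).imp (·.mul_right _) (·.mul_right _)
  conv_lhs => rw [← Nat.div_add_mod a (2 ^ (n - 2))]
  exact key _ _

/-- Telescoping of `dElt_mul`; `e` is `1 + 3 + ⋯ + 3 ^ (m - 1)`. -/
theorem prod_dElt_three_pow (h0 : α ≠ 0) (m : ℕ) :
    ∃ e : ℤ, 2 * e = 3 ^ m - 1 ∧
      (∏ k ∈ Finset.range m, dElt α (3 ^ k)) * α ^ e * (1 - α) = 1 - α ^ ((3 : ℤ) ^ m) := by
  induction m with
  | zero => exact ⟨0, by simp, by simp⟩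
  | succ m ih =>
    obtain ⟨e, he, h⟩ := ih
    refine ⟨e + 3 ^ m, by rw [pow_succ]; linarith, ?_⟩
    rw [Finset.prod_range_succ, zpow_add₀ h0, pow_succ' 3 m, ← dElt_mul h0, ← h]
    ring

/-- After `2 ^ (n - 2)` factors the telescoped right side is again `1 - α`, while `e` is an odd
multiple of `2 ^ (n - 1)`, so `α ^ e = -1`. -/
theorem prod_range_dElt_three_pow (hn : 3 ≤ n) (hα : IsPrimitiveRoot α (2 ^ n)) :
    ∏ k ∈ Finset.range (2 ^ (n - 2)), dElt α (3 ^ k) = -1 := by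
  have h0 : α ≠ 0 := hα.ne_zero (by positivity)
  obtain ⟨e, he, h⟩ := prod_dElt_three_pow h0 (2 ^ (n - 2))
  obtain ⟨k, rfl⟩ := Nat.exists_eq_add_of_le' hn
  obtain ⟨c, hc, h3⟩ := three_pow_two_pow k
  rw [show k + 3 - 2 = k + 1 by omega] at he h ⊢
  have hec : e = 2 ^ (k + 3 - 1) * c := by
    rw [show k + 3 - 1 = k + 2 by omega]
    rw [h3] at he
    have : (2 : ℤ) * e = 2 * (2 ^ (k + 2) * c) := by rw [he]; ring
    linarith
  have h1 : α ^ ((3 : ℤ) ^ 2 ^ (k + 1)) = α := by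
    conv_rhs => rw [← zpow_one α]
    exact zpow_eq_of_dvd_sub hα ⟨c, by rw [h3]; ring⟩
  rw [h1, hec, zpow_eq_neg_one_of_odd (by omega) hα hc] at h
  have h2 : 1 - α ≠ 0 := sub_ne_zero.mpr (hα.ne_one (Nat.one_lt_two_pow (by omega))).symm
  have := mul_right_cancel₀ h2 (h.trans (one_mul _).symm)
  linear_combination -this

/-- The residues `1, 3, …, 2 ^ (n - 1) - 1` and the powers of three agree up to order and sign. -/
theorem exists_equiv_three_pow (hn : 2 ≤ n) :
    ∃ e : Fin (2 ^ (n - 2)) ≃ ZMod (2 ^ (n - 2)), ∀ l : Fin (2 ^ (n - 2)),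
      (2 : ℤ) ^ n ∣ (2 * (l : ℕ) + 1 : ℤ) - 3 ^ (e l).val ∨
      (2 : ℤ) ^ n ∣ (2 * (l : ℕ) + 1 : ℤ) + 3 ^ (e l).val := by
  choose f hf hfd using fun l : Fin (2 ^ (n - 2)) =>
    odd_eq_three_pow_lt n hn (2 * (l : ℕ) + 1) (odd_two_mul_add_one _)
  have hval : ∀ l, ((f l : ℕ) : ZMod (2 ^ (n - 2))).val = f l := fun l =>
    ZMod.val_cast_of_lt (hf l)
  have hinj : Function.Injective fun l => ((f l : ℕ) : ZMod (2 ^ (n - 2))) := by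
    intro l l' h
    have hff : f l = f l' := by rw [← hval l, ← hval l']; exact congrArg ZMod.val h
    have hd : (2 : ℤ) ^ n ∣ (2 * (l : ℕ) + 1 : ℤ) - (2 * (l' : ℕ) + 1) ∨
        (2 : ℤ) ^ n ∣ (2 * (l : ℕ) + 1 : ℤ) + (2 * (l' : ℕ) + 1) := by
      have h1 := hfd l
      have h2 := hfd l'
      rw [← hff] at h2
      rcases h1 with ⟨a, ha⟩ | ⟨a, ha⟩ <;> rcases h2 with ⟨b, hb⟩ | ⟨b, hb⟩
      · exact Or.inl ⟨a - b, by linear_combination ha - hb⟩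
      · exact Or.inr ⟨a + b, by linear_combination ha + hb⟩
      · exact Or.inr ⟨a + b, by linear_combination ha + hb⟩
      · exact Or.inl ⟨a - b, by linear_combination ha - hb⟩
    have hl := l.2
    have hl' := l'.2
    have hpow : (2 : ℤ) ^ n = 4 * (2 ^ (n - 2) : ℕ) := by
      obtain ⟨k, rfl⟩ := Nat.exists_eq_add_of_le' hn
      push_cast
      ring
    rw [hpow] at hd
    ext
    generalize 2 ^ (n - 2) = M at *
    -- With `M = 2 ^ (n - 2)`, the difference and the sum of the two odd numbers are below `4 * M`
    -- in absolute value, so divisibility makes them zero; the sum is positive.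
    rcases hd with h | h
    · have := Int.eq_zero_of_abs_lt_dvd h (by rw [abs_lt]; omega)
      omega
    · have := Int.eq_zero_of_abs_lt_dvd h (by rw [abs_lt]; omega)
      omega
  refine ⟨Equiv.ofBijective _ ((Fintype.bijective_iff_injective_and_card _).mpr
    ⟨hinj, by simp [ZMod.card]⟩), fun l => ?_⟩
  rw [Equiv.ofBijective_apply, hval]
  exact hfd l

theorem prod_zmod_val {R : Type*} [CommMonoid R] (M : ℕ) [NeZero M] (f : ℕ → R) :
    ∏ k : ZMod M, f k.val = ∏ k ∈ Finset.range M, f k := by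
  refine Finset.prod_nbij ZMod.val (fun k _ => Finset.mem_range.mpr (ZMod.val_lt k))
    (ZMod.val_injective M).injOn ?_ fun _ _ => rfl
  intro k hk
  exact ⟨(k : ZMod M), by simp, ZMod.val_cast_of_lt (by simpa using hk)⟩

theorem prod_dElt_odd (hn : 2 ≤ n) (hα : IsPrimitiveRoot α (2 ^ n)) :
    ∏ l ∈ Finset.range (2 ^ (n - 2)), dElt α (2 * (l : ℤ) + 1) =
      ∏ k ∈ Finset.range (2 ^ (n - 2)), dElt α (3 ^ k) := by
  obtain ⟨e, he⟩ := exists_equiv_three_pow hn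
  rw [← prod_zmod_val _ fun k => dElt α (3 ^ k),
    ← Fin.prod_univ_eq_prod_range (fun l : ℕ => dElt α (2 * (l : ℤ) + 1))]
  exact Fintype.prod_equiv e _ _ fun l => dElt_congr hα (he l)

theorem prod_dElt_odd_sq (hn : 2 ≤ n) (hα : IsPrimitiveRoot α (2 ^ n)) :
    (∏ l ∈ Finset.range (2 ^ (n - 2)), dElt α (2 * (l : ℤ) + 1)) ^ 2 = 1 := by
  rcases hn.eq_or_lt with rfl | hn'
  · have h : α ^ 2 = -1 := pow_two_pow_pred_eq_neg_one one_le_two hα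
    have h0 : α ≠ 0 := hα.ne_zero (by positivity)
    have h1 : α⁻¹ = -α := by
      rw [inv_eq_iff_eq_inv]
      apply eq_inv_of_mul_eq_one_left
      linear_combination -h
    simp [dElt, h1]
  · rw [prod_dElt_odd hn hα, prod_range_dElt_three_pow hn' hα, neg_one_sq]

end Elements

/-! ### Circular units and the group `D`. -/

section Circular

variable {K : Type*} [Field K] {n : ℕ} {α : K}

theorem exists_unit_of_mul_eq_one {x y : K} (hx : IsIntegral ℤ x) (hy : IsIntegral ℤ y)
    (h : x * y = 1) : ∃ w : (𝓞 K)ˣ, ((w : 𝓞 K) : K) = x :=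
  ⟨⟨⟨x, hx⟩, ⟨y, hy⟩, NumberField.RingOfIntegers.ext h,
    NumberField.RingOfIntegers.ext ((mul_comm y x).trans h)⟩, rfl⟩

theorem isIntegral_of_mem_adjoin (hα : IsPrimitiveRoot α (2 ^ n)) {z : K}
    (hz : z ∈ Algebra.adjoin ℤ {α}) : IsIntegral ℤ z := by
  have h1 : IsIntegral ℤ α := hα.isIntegral (by positivity)
  exact adjoin_le_integralClosure h1 hz

theorem coe_unit_mul (d d' : (𝓞 K)ˣ) :
    (((d * d' : (𝓞 K)ˣ) : 𝓞 K) : K) = ((d : 𝓞 K) : K) * ((d' : 𝓞 K) : K) := by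
  simp

theorem coe_unit_inv (d : (𝓞 K)ˣ) : (((d⁻¹ : (𝓞 K)ˣ) : 𝓞 K) : K) = ((d : 𝓞 K) : K)⁻¹ := by
  apply eq_inv_of_mul_eq_one_left
  rw [← coe_unit_mul, inv_mul_cancel]
  simp

/-- If `3 * m ≡ 1` modulo `2 ^ n`, then `1 - α ^ j = 1 - (α ^ (3 * j)) ^ m` is divisible by `1 - α ^
(3 * j)`; the geometric sum supplies the inverse. -/
theorem exists_unit_dElt (hα : IsPrimitiveRoot α (2 ^ n)) {j : ℤ} (hj : Odd j) (hn : 1 ≤ n) :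
    ∃ w : (𝓞 K)ˣ, ((w : 𝓞 K) : K) = dElt α j := by
  have h0 : α ≠ 0 := hα.ne_zero (by positivity)
  obtain ⟨m, c, hm⟩ : ∃ m : ℕ, (2 : ℤ) ^ n ∣ 3 * m - 1 := by
    have hco : IsCoprime (3 : ℤ) (2 ^ n) := IsCoprime.pow_right (by norm_num)
    obtain ⟨a, b, hab⟩ := hco
    refine ⟨(a % 2 ^ n).toNat, ?_⟩
    rw [Int.toNat_of_nonneg (Int.emod_nonneg _ (by positivity)), Int.emod_def]
    exact ⟨-b - 3 * (a / 2 ^ n), by linear_combination hab⟩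
  refine exists_unit_of_mul_eq_one (y := α ^ j * ∑ i ∈ Finset.range m, (α ^ (3 * j)) ^ i)
    (isIntegral_of_mem_adjoin hα ?_) (isIntegral_of_mem_adjoin hα ?_) ?_
  · exact add_mem (add_mem (one_mem _) (zpow_mem_adjoin hα _)) (zpow_mem_adjoin hα _)
  · exact mul_mem (zpow_mem_adjoin hα _)
      (sum_mem fun i _ => pow_mem (zpow_mem_adjoin hα _) i)
  · have h1 : (α ^ (3 * j)) ^ m = α ^ j := by
      rw [← zpow_natCast, ← zpow_mul]
      exact zpow_eq_of_dvd_sub hα ⟨c * j, by linear_combination j * hm⟩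
    have h2 := mul_neg_geom_sum (α ^ (3 * j)) m
    rw [h1, ← dElt_mul h0] at h2
    have h3 : 1 - α ^ j ≠ 0 := sub_ne_zero.mpr (zpow_ne_one_of_odd hn hα hj).symm
    apply mul_right_cancel₀ h3
    rw [one_mul]
    linear_combination h2

/-- The elements `α ^ k * d * (1 - α) ^ e` with `d ∈ D`, as a subgroup of `Kˣ`. -/
def rootMulD (n : ℕ) (α : K) (h0 : α ≠ 0) (h1 : 1 - α ≠ 0) : Subgroup Kˣ where
  carrier := {x | ∃ k e : ℤ, ∃ d ∈ groupD n α, (x : K) = α ^ k * ((d : 𝓞 K) : K) * (1 - α) ^ e}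
  one_mem' := ⟨0, 0, 1, one_mem _, by simp⟩
  mul_mem' := by
    rintro x y ⟨k, e, d, hd, hx⟩ ⟨k', e', d', hd', hy⟩
    refine ⟨k + k', e + e', d * d', mul_mem hd hd', ?_⟩
    rw [Units.val_mul, hx, hy, coe_unit_mul, zpow_add₀ h0, zpow_add₀ h1]
    ring
  inv_mem' := by
    rintro x ⟨k, e, d, hd, hx⟩
    refine ⟨-k, -e, d⁻¹, inv_mem hd, ?_⟩
    rw [Units.val_inv_eq_inv_val, hx, coe_unit_inv, zpow_neg, zpow_neg, mul_inv, mul_inv]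

variable {h0 : α ≠ 0} {h1 : 1 - α ≠ 0}

theorem root_mem_rootMulD {x : Kˣ} {k : ℤ} (hx : (x : K) = α ^ k) : x ∈ rootMulD n α h0 h1 :=
  ⟨k, 0, 1, one_mem _, by simp [hx]⟩

theorem dElt_mem_rootMulD_of_lt {x : Kˣ} {l : ℕ} (hn : 2 ≤ n) (hα : IsPrimitiveRoot α (2 ^ n))
    (hl : l < 2 ^ (n - 2) - 1) (hx : (x : K) = dElt α (2 * (l : ℤ) + 1)) :
    x ∈ rootMulD n α h0 h1 := by
  obtain ⟨w, hw⟩ := exists_unit_dElt hα (odd_two_mul_add_one (l : ℤ)) (by omega)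
  exact ⟨0, 0, w, Subgroup.subset_closure ⟨l, Finset.mem_range.mpr hl, hw⟩, by simp [hx, hw]⟩

/-- Up to sign, `j` is congruent to one of `1, 3, …, 2 ^ (n - 1) - 1`. Only the last is missing from
the generators of `D`, and it is recovered because the product of all of them is `±1`. -/
theorem dElt_mem_rootMulD {x : Kˣ} {j : ℤ} (hn : 2 ≤ n) (hα : IsPrimitiveRoot α (2 ^ n))
    (hj : Odd j) (hx : (x : K) = dElt α j) : x ∈ rootMulD n α h0 h1 := by
  obtain ⟨k, hk, hkj⟩ := odd_eq_three_pow_lt n hn j hj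
  obtain ⟨e, he⟩ := exists_equiv_three_pow hn
  set l := e.symm (k : ZMod (2 ^ (n - 2))) with hl
  have hd : dElt α j = dElt α (2 * ((l : ℕ) : ℤ) + 1) := by
    rw [dElt_congr hα hkj, dElt_congr hα (he l), hl, Equiv.apply_symm_apply,
      ZMod.val_cast_of_lt hk]
  rw [hd] at hx
  obtain ⟨l, hlt⟩ := l
  simp only at hx
  rcases Nat.lt_or_ge l (2 ^ (n - 2) - 1) with hl' | hl'
  · exact dElt_mem_rootMulD_of_lt hn hα hl' hx
  · obtain rfl : l = 2 ^ (n - 2) - 1 := by omega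
    have hne : ∀ l : ℕ, dElt α (2 * (l : ℤ) + 1) ≠ 0 := fun l =>
      dElt_ne_zero (by omega) hα (odd_two_mul_add_one _)
    set y : ℕ → Kˣ := fun l => Units.mk0 _ (hne l) with hy
    have hprod : (∏ l ∈ Finset.range (2 ^ (n - 2) - 1), y l) * x =
        ∏ l ∈ Finset.range (2 ^ (n - 2)), y l := by
      conv_rhs => rw [show 2 ^ (n - 2) = 2 ^ (n - 2) - 1 + 1 by omega, Finset.prod_range_succ]
      congr 1
      exact Units.ext hx
    have hmem : ∏ l ∈ Finset.range (2 ^ (n - 2)), y l ∈ rootMulD n α h0 h1 := by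
      have hval : ((∏ l ∈ Finset.range (2 ^ (n - 2)), y l : Kˣ) : K) ^ 2 = 1 ^ 2 := by
        rw [Units.coe_prod, one_pow]
        exact prod_dElt_odd_sq hn hα
      rcases eq_or_eq_neg_of_sq_eq_sq _ _ hval with h | h
      · exact root_mem_rootMulD (k := 0) (by rw [h, zpow_zero])
      · refine root_mem_rootMulD (k := (2 ^ (n - 1) : ℕ)) ?_
        rw [h, zpow_natCast, pow_two_pow_pred_eq_neg_one (by omega) hα]
    rw [← eq_inv_mul_iff_mul_eq] at hprod
    rw [hprod]
    exact mul_mem (inv_mem (prod_mem fun l hl =>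
      dElt_mem_rootMulD_of_lt hn hα (Finset.mem_range.mp hl) rfl)) hmem

theorem one_sub_three_pow_mem_rootMulD (hn : 2 ≤ n) (hα : IsPrimitiveRoot α (2 ^ n)) (k : ℕ)
    (x : Kˣ) (hx : (x : K) = 1 - α ^ ((3 : ℤ) ^ k)) : x ∈ rootMulD n α h0 h1 := by
  induction k generalizing x with
  | zero => exact ⟨0, 1, 1, one_mem _, by simp [hx]⟩
  | succ k ih =>
    have hodd : Odd ((3 : ℤ) ^ k) := Odd.pow (by decide)
    have hd := dElt_ne_zero (by omega) hα hodd
    have hs : 1 - α ^ ((3 : ℤ) ^ k) ≠ 0 :=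
      sub_ne_zero.mpr (zpow_ne_one_of_odd (by omega) hα hodd).symm
    have : x = Units.mk0 _ hd * Units.mk0 _ (zpow_ne_zero ((3 : ℤ) ^ k) h0) * Units.mk0 _ hs := by
      ext
      rw [hx, pow_succ', ← dElt_mul h0]
      rfl
    rw [this]
    exact mul_mem (mul_mem (dElt_mem_rootMulD hn hα hodd rfl) (root_mem_rootMulD rfl)) (ih _ rfl)

theorem one_sub_odd_mem_rootMulD (hn : 2 ≤ n) (hα : IsPrimitiveRoot α (2 ^ n)) {j : ℤ}
    (hj : Odd j) (x : Kˣ) (hx : (x : K) = 1 - α ^ j) : x ∈ rootMulD n α h0 h1 := by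
  obtain ⟨k, hk | hk⟩ := odd_eq_three_pow n j hj
  · exact one_sub_three_pow_mem_rootMulD hn hα k x (by rw [hx, zpow_eq_of_dvd_sub hα hk])
  · have hj' : α ^ j = (α ^ ((3 : ℤ) ^ k))⁻¹ := by
      rw [← zpow_neg]
      exact zpow_eq_of_dvd_sub hα (by rwa [sub_neg_eq_add])
    have hs : 1 - α ^ ((3 : ℤ) ^ k) ≠ 0 :=
      sub_ne_zero.mpr (zpow_ne_one_of_odd (by omega) hα (Odd.pow (by decide))).symm
    have hz : α ^ ((3 : ℤ) ^ k) ≠ 0 := zpow_ne_zero _ h0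
    have : x = Units.mk0 _ (zpow_ne_zero ((2 ^ (n - 1) : ℕ) - (3 : ℤ) ^ k) h0) *
        Units.mk0 _ hs := by
      ext
      rw [hx, hj', Units.val_mul, Units.val_mk0, Units.val_mk0, zpow_sub₀ h0, zpow_natCast,
        pow_two_pow_pred_eq_neg_one (by omega) hα]
      field_simp
      ring
    rw [this]
    exact mul_mem (root_mem_rootMulD rfl) (one_sub_three_pow_mem_rootMulD hn hα k _ rfl)

/-- Induction on `a` by `1 - y ^ 2 = (1 - y) * (1 - (-y))`, where `-y` is again `α` to `2 ^ a` times
an odd number. -/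
theorem one_sub_two_pow_mul_odd_mem_rootMulD (hn : 2 ≤ n) (hα : IsPrimitiveRoot α (2 ^ n))
    {a : ℕ} (ha : a + 1 ≤ n) {b : ℤ} (hb : Odd b) (x : Kˣ) (hx : (x : K) = 1 - α ^ (2 ^ a * b)) :
    x ∈ rootMulD n α h0 h1 := by
  induction a generalizing b x with
  | zero => exact one_sub_odd_mem_rootMulD hn hα hb x (by simpa using hx)
  | succ a ih =>
    have hsq : α ^ (2 ^ (a + 1) * b) = (α ^ (2 ^ a * b)) ^ 2 := by
      rw [← zpow_natCast, ← zpow_mul]; congr 1; push_cast; ring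
    have hneg : α ^ (2 ^ a * (b + 2 ^ (n - 1 - a))) = - α ^ (2 ^ a * b) := by
      have := zpow_eq_neg_one_of_odd (show 1 ≤ n by omega) hα odd_one
      rw [mul_one] at this
      rw [mul_add, zpow_add₀ h0, ← pow_add, show a + (n - 1 - a) = n - 1 by omega, this,
        mul_neg_one]
    have hfac : (x : K) = (1 - α ^ (2 ^ a * b)) * (1 - α ^ (2 ^ a * (b + 2 ^ (n - 1 - a)))) := by
      rw [hx, hsq, hneg]; ring
    have hne : (1 - α ^ (2 ^ a * b)) * (1 - α ^ (2 ^ a * (b + 2 ^ (n - 1 - a)))) ≠ 0 := by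
      rw [← hfac]; exact x.ne_zero
    have : x = Units.mk0 _ (left_ne_zero_of_mul hne) * Units.mk0 _ (right_ne_zero_of_mul hne) :=
      Units.ext hfac
    rw [this]
    refine mul_mem (ih (by omega) hb _ rfl) (ih (by omega) (b := b + 2 ^ (n - 1 - a)) ?_ _ rfl)
    exact hb.add_even ((even_two (α := ℤ)).pow_of_ne_zero (by omega))

theorem oneSubPowGroup_le (hn : 2 ≤ n) (hα : IsPrimitiveRoot α (2 ^ n)) :
    oneSubPowGroup n α ≤ rootMulD n α h0 h1 := by
  rw [oneSubPowGroup, Subgroup.closure_le]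
  rintro x ⟨k, hk, hx⟩
  rw [Finset.mem_Icc] at hk
  obtain ⟨a, b, hb, rfl⟩ := Nat.exists_eq_two_pow_mul_odd (n := k) (by omega)
  have ha : a < n := by
    rw [← Nat.pow_lt_pow_iff_right (one_lt_two)]
    have : 2 ^ a * 1 ≤ 2 ^ a * b := Nat.mul_le_mul_left _ hb.pos
    omega
  refine one_sub_two_pow_mul_odd_mem_rootMulD hn hα (a := a) ha (b := (b : ℤ))
    (by exact_mod_cast hb) x ?_
  rw [hx]
  norm_cast

theorem neg_one_mem_oneSubPowGroup (hn : 2 ≤ n) (hα : IsPrimitiveRoot α (2 ^ n)) (h0 : α ≠ 0) :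
    (-1 : Kˣ) ∈ oneSubPowGroup n α ∧ Units.mk0 α h0 ∈ oneSubPowGroup n α := by
  have hpow : 2 ≤ 2 ^ (n - 1) := by
    calc 2 = 2 ^ 1 := rfl
      _ ≤ 2 ^ (n - 1) := Nat.pow_le_pow_right (by norm_num) (by omega)
  have hN : 2 ^ n = 2 * 2 ^ (n - 1) := by rw [← pow_succ', Nat.sub_add_cancel (by omega)]
  have h1 : 1 - α ≠ 0 := sub_ne_zero.mpr (hα.ne_one (by omega)).symm
  have hlast : α ^ (2 ^ n - 1) = α⁻¹ := by
    apply eq_inv_of_mul_eq_one_left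
    rw [← pow_succ, Nat.sub_add_cancel (by omega), hα.pow_eq_one]
  have h2 : 1 - α⁻¹ ≠ 0 := by
    rw [sub_ne_zero, ne_comm, Ne, inv_eq_one]; exact (sub_ne_zero.mp h1).symm
  have hA : Units.mk0 _ h1 ∈ oneSubPowGroup n α :=
    Subgroup.subset_closure ⟨1, by rw [Finset.mem_Icc]; omega, by simp⟩
  have hB : Units.mk0 _ h2 ∈ oneSubPowGroup n α :=
    Subgroup.subset_closure ⟨2 ^ n - 1, by rw [Finset.mem_Icc]; omega, by simp [hlast]⟩
  -- Here `-α = (1 - α) / (1 - α⁻¹)`; its power with even exponent `2 ^ (n - 1)` is `-1`.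
  have hC : -Units.mk0 α h0 ∈ oneSubPowGroup n α := by
    have : -Units.mk0 α h0 = Units.mk0 _ h1 * (Units.mk0 _ h2)⁻¹ := by
      rw [eq_mul_inv_iff_mul_eq]
      ext
      simp [h0, mul_sub]
    rw [this]
    exact mul_mem hA (inv_mem hB)
  have hD : (-1 : Kˣ) ∈ oneSubPowGroup n α := by
    have : (-1 : Kˣ) = (-Units.mk0 α h0) ^ 2 ^ (n - 1) := by
      have heven : Even (2 ^ (n - 1)) := (even_two (α := ℕ)).pow_of_ne_zero (by omega)
      rw [heven.neg_pow]
      ext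
      simp [pow_two_pow_pred_eq_neg_one (show 1 ≤ n by omega) hα]
    rw [this]
    exact pow_mem hC _
  refine ⟨hD, ?_⟩
  rw [← neg_neg (Units.mk0 α h0), ← neg_one_mul (-Units.mk0 α h0)]
  exact mul_mem hD hC

theorem one_sub_mem_oneSubPowGroup (hα : IsPrimitiveRoot α (2 ^ n))
    (x : Kˣ) (j : ℤ) (hx : (x : K) = 1 - α ^ j) : x ∈ oneSubPowGroup n α := by
  have hj : α ^ j = α ^ (j % 2 ^ n) := zpow_eq_of_dvd_sub hα Int.dvd_self_sub_emod
  have hlt : j % 2 ^ n < 2 ^ n := Int.emod_lt_of_pos _ (by positivity)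
  rw [hj] at hx
  lift j % 2 ^ n to ℕ using Int.emod_nonneg _ (by positivity) with i
  have hi : i ≠ 0 := by
    rintro rfl
    simp at hx
  have hlt' : i < 2 ^ n := by exact_mod_cast hlt
  exact Subgroup.subset_closure ⟨i, by rw [Finset.mem_Icc]; omega, by rw [hx, zpow_natCast]⟩

theorem groupD_le_circularUnits (hn : 2 ≤ n) (hα : IsPrimitiveRoot α (2 ^ n)) :
    groupD n α ≤ circularUnits n α := by
  have h0 : α ≠ 0 := hα.ne_zero (by positivity)
  rw [groupD, Subgroup.closure_le]
  rintro w ⟨l, -, hw⟩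
  have hodd := odd_two_mul_add_one (l : ℤ)
  have h1 : 1 - α ^ (2 * (l : ℤ) + 1) ≠ 0 :=
    sub_ne_zero.mpr (zpow_ne_one_of_odd (by omega) hα hodd).symm
  have h3 : 1 - α ^ (3 * (2 * (l : ℤ) + 1)) ≠ 0 :=
    sub_ne_zero.mpr (zpow_ne_one_of_odd (by omega) hα (Odd.mul (by decide) hodd)).symm
  have hα' := (neg_one_mem_oneSubPowGroup hn hα h0).2
  have : Units.map (algebraMap (𝓞 K) K).toMonoidHom w =
      Units.mk0 _ h3 * (Units.mk0 α h0 ^ (2 * (l : ℤ) + 1) * Units.mk0 _ h1)⁻¹ := by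
    rw [eq_mul_inv_iff_mul_eq]
    ext
    have := dElt_mul h0 (2 * (l : ℤ) + 1)
    rw [← hw, mul_assoc] at this
    simpa using this
  change Units.map (algebraMap (𝓞 K) K).toMonoidHom w ∈ oneSubPowGroup n α
  rw [this]
  exact mul_mem (one_sub_mem_oneSubPowGroup hα _ _ rfl)
    (inv_mem (mul_mem (zpow_mem hα' _) (one_sub_mem_oneSubPowGroup hα _ _ rfl)))

theorem neg_one_mem_circularUnits (hn : 2 ≤ n) (hα : IsPrimitiveRoot α (2 ^ n)) :
    -1 ∈ circularUnits n α := by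
  change Units.map (algebraMap (𝓞 K) K).toMonoidHom (-1) ∈ oneSubPowGroup n α
  have : Units.map (algebraMap (𝓞 K) K).toMonoidHom (-1) = -1 := by ext; simp
  rw [this]
  exact (neg_one_mem_oneSubPowGroup hn hα (hα.ne_zero (by positivity))).1

theorem algEquiv_inv_groupD [NumberField K] {c : K ≃ₐ[ℚ] K} (hc : c α = α⁻¹)
    {d : (𝓞 K)ˣ} (hd : d ∈ groupD n α) : c ((d : 𝓞 K) : K) = ((d : 𝓞 K) : K) := by
  induction hd using Subgroup.closure_induction with
  | mem w hw =>
    obtain ⟨l, -, hw⟩ := hw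
    rw [hw, map_dElt, hc, ← zpow_neg_one, dElt_zpow, neg_one_mul, dElt_neg]
  | one => simp
  | mul x y _ _ hx hy => rw [coe_unit_mul, map_mul, hx, hy]
  | inv x _ hx => rw [coe_unit_inv, map_inv₀, hx]

/-- The index `k₀` belongs to the omitted element `d_{2^(n-1) - 1}`, so its exponent can always be
taken to be zero. -/
theorem exists_prod_of_mem_groupD (hn : 2 ≤ n) (hα : IsPrimitiveRoot α (2 ^ n)) :
    ∃ k₀ : ZMod (2 ^ (n - 2)), ∀ d ∈ groupD n α, ∃ m : ZMod (2 ^ (n - 2)) → ℤ, m k₀ = 0 ∧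
      ((d : 𝓞 K) : K) = ∏ k, dElt α (3 ^ k.val) ^ m k := by
  obtain ⟨e, he⟩ := exists_equiv_three_pow hn
  have hpos : 0 < 2 ^ (n - 2) := by positivity
  refine ⟨e ⟨2 ^ (n - 2) - 1, by omega⟩, fun d hd => ?_⟩
  have hne : ∀ k : ZMod (2 ^ (n - 2)), dElt α (3 ^ k.val) ≠ 0 := fun k =>
    dElt_ne_zero (by omega) hα (Odd.pow (by decide))
  induction hd using Subgroup.closure_induction with
  | mem w hw =>
    obtain ⟨l, hl, hw⟩ := hw
    rw [Finset.mem_range] at hl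
    refine ⟨Pi.single (e ⟨l, by omega⟩) 1, ?_, ?_⟩
    · rw [Pi.single_apply, if_neg]
      rw [e.injective.eq_iff, Fin.mk.injEq]
      omega
    · rw [hw, Finset.prod_eq_single (e ⟨l, by omega⟩), Pi.single_eq_same, zpow_one]
      · exact dElt_congr hα (he ⟨l, by omega⟩)
      · intro k _ hk
        rw [Pi.single_eq_of_ne hk, zpow_zero]
      · simp
  | one => exact ⟨0, rfl, by simp⟩
  | mul x y _ _ hx hy =>
    obtain ⟨m, hm, hx⟩ := hx
    obtain ⟨m', hm', hy⟩ := hy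
    refine ⟨m + m', by simp [hm, hm'], ?_⟩
    rw [coe_unit_mul, hx, hy, ← Finset.prod_mul_distrib]
    exact Finset.prod_congr rfl fun k _ => (zpow_add₀ (hne k) _ _).symm
  | inv x _ hx =>
    obtain ⟨m, hm, hx⟩ := hx
    refine ⟨-m, by simp [hm], ?_⟩
    rw [coe_unit_inv, hx, ← Finset.prod_inv_distrib]
    exact Finset.prod_congr rfl fun k _ => (zpow_neg _ _).symm

theorem exists_real_dElt (hn : 1 ≤ n) (hα : IsPrimitiveRoot α (2 ^ n)) (φ : K →+* ℂ) {j : ℤ}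
    (hj : Odd j) : ∃ r : ℝˣ, φ (dElt α j) = ((r : ℝ) : ℂ) := by
  have hz : IsPrimitiveRoot (φ α) (2 ^ n) := hα.map_of_injective φ.injective
  have hnorm : ‖φ α‖ = 1 := Complex.norm_eq_one_of_pow_eq_one hz.pow_eq_one (by positivity)
  have hconj : (starRingEnd ℂ) (φ α) = (φ α) ^ (-1 : ℤ) := by
    rw [zpow_neg_one, Complex.inv_eq_conj hnorm]
  have hreal : (starRingEnd ℂ) (φ (dElt α j)) = φ (dElt α j) := by
    rw [map_dElt, map_dElt, hconj, dElt_zpow, neg_one_mul, dElt_neg]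
  obtain ⟨r, hr⟩ := Complex.conj_eq_iff_real.mp hreal
  have hr0 : r ≠ 0 := by
    rintro rfl
    exact dElt_ne_zero hn hα hj (φ.injective (by rw [hr, map_zero]; simp))
  exact ⟨Units.mk0 r hr0, hr⟩

variable [NumberField K]

theorem norm_zpow (z : K) (hz : z ≠ 0) (e : ℤ) :
    Algebra.norm ℚ (z ^ e) = Algebra.norm ℚ z ^ e := by
  have h := congrArg Units.val (map_zpow (Units.map (Algebra.norm ℚ)) (Units.mk0 z hz) e)
  rw [Units.val_zpow_eq_zpow_val, Units.coe_map, Units.coe_map, Units.val_zpow_eq_zpow_val] at h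
  exact h

variable [IsCyclotomicExtension {2 ^ n} ℚ K]

/-- Every circular unit is the product of a root of unity and an element of `D`. -/
theorem exists_eq_of_mem_circularUnits (hn : 2 ≤ n) (hα : IsPrimitiveRoot α (2 ^ n))
    {β : (𝓞 K)ˣ} (hβ : β ∈ circularUnits n α) :
    ∃ k : ℤ, ∃ d ∈ groupD n α, ((β : 𝓞 K) : K) = α ^ k * ((d : 𝓞 K) : K) := by
  have h0 : α ≠ 0 := hα.ne_zero (by positivity)
  have h1 : 1 - α ≠ 0 := sub_ne_zero.mpr (hα.ne_one (Nat.one_lt_two_pow (by omega))).symm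
  obtain ⟨k, e, d, hd, h⟩ := oneSubPowGroup_le (h0 := h0) (h1 := h1) hn hα hβ
  change ((β : 𝓞 K) : K) = _ at h
  refine ⟨k, d, hd, ?_⟩
  have hirr := Polynomial.cyclotomic.irreducible_rat (n := 2 ^ n) (by positivity)
  have hnorm : Algebra.norm ℚ (α - 1) = 2 := hα.norm_sub_one_two hn hirr
  have hunit : ∀ w : (𝓞 K)ˣ, |Algebra.norm ℚ ((w : 𝓞 K) : K)| = 1 := fun w => by
    have := NumberField.isUnit_iff_norm.mp w.isUnit
    rwa [RingOfIntegers.coe_norm] at this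
  obtain ⟨ζ, hζ⟩ := exists_unit_of_mul_eq_one (K := K) (x := α ^ k) (y := α ^ (-k))
    (isIntegral_of_mem_adjoin hα (zpow_mem_adjoin hα _))
    (isIntegral_of_mem_adjoin hα (zpow_mem_adjoin hα _))
    (by rw [← zpow_add₀ h0, add_neg_cancel, zpow_zero])
  -- The norm of `1 - α` is `±2` and units have norm `±1`, so the exponent `e` of `1 - α` must
  -- vanish.
  have hN := congrArg (fun z => |Algebra.norm ℚ z|) h
  simp only [map_mul, norm_zpow _ h1, abs_mul, hunit, ← hζ, one_mul] at hN
  have h1n : |Algebra.norm ℚ (1 - α)| = 2 := by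
    rw [show 1 - α = ((-1 : (𝓞 K)ˣ) : 𝓞 K) * (α - 1) by simp, map_mul, abs_mul, hunit, hnorm]
    norm_num
  rw [abs_zpow, h1n] at hN
  have he : e = 0 := by
    rwa [eq_comm, zpow_eq_one_iff_right₀ (by norm_num) (by norm_num)] at hN
  rw [h, he, zpow_zero, mul_one]

/-- The signs of the conjugates of the `d_j` are independent enough to exclude `-1` from `D`. -/
theorem neg_one_notMem_groupD (hn : 2 ≤ n) (hα : IsPrimitiveRoot α (2 ^ n)) :
    -1 ∉ groupD n α := by
  intro hmem
  rcases hn.eq_or_lt with rfl | hn'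
  · have hbot : groupD 2 α = ⊥ := by simp [groupD]
    rw [hbot, Subgroup.mem_bot] at hmem
    have h := congrArg (fun w : (𝓞 K)ˣ => ((w : 𝓞 K) : K)) hmem
    norm_num at h
  · obtain ⟨k₀, hk₀⟩ := exists_prod_of_mem_groupD (K := K) hn hα
    obtain ⟨m, hm, hprod⟩ := hk₀ _ hmem
    obtain ⟨φ⟩ : Nonempty (K →+* ℂ) := inferInstance
    have hodd : ∀ k : ℕ, Odd ((3 : ℤ) ^ k) := fun k => Odd.pow (by decide)
    choose r hr using fun k : ZMod (2 ^ (n - 2)) =>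
      exists_real_dElt (show 1 ≤ n by omega) hα φ (hodd k.val)
    have hsum : ∏ k, r k = -1 := by
      have h := congrArg φ (prod_range_dElt_three_pow hn' hα)
      rw [← prod_zmod_val _ fun k => dElt α (3 ^ k), map_prod,
        Finset.prod_congr rfl fun k _ => hr k] at h
      ext
      rw [map_neg, map_one] at h
      push_cast
      exact_mod_cast h
    -- The automorphism `α ↦ α ^ (3 ^ t)` shifts the index of `d_{3^k}` by `t` and fixes `-1`.
    have hrel : ∀ t, ∏ k, r (k + t) ^ m k = -1 := by
      intro t
      obtain ⟨σ, hσ⟩ := exists_algEquiv_apply_eq_zpow hα (hodd t.val)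
      have hstep : ∀ k : ZMod (2 ^ (n - 2)),
          φ (σ (dElt α (3 ^ k.val))) = ((r (k + t) : ℝ) : ℂ) := by
        intro k
        rw [← hr, map_dElt σ, hσ, dElt_zpow, ← pow_add, dElt_three_pow_mod hn hα, ZMod.val_add,
          add_comm t.val]
      have h := congrArg (fun z => φ (σ z)) hprod
      simp only [map_prod, map_zpow₀, hstep] at h
      ext
      simp only [Units.val_neg, Units.val_one, map_neg, map_one] at h
      push_cast
      exact_mod_cast h.symm
    set s : ZMod (2 ^ (n - 2)) → ZMod 2 := fun k => (signHom (r k)).toAdd with hs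
    have h1 : ∑ k, s k = 1 := by
      have h := congrArg (fun z => (signHom z).toAdd) hsum
      simpa [map_prod, toAdd_prod, signHom_neg_one] using h
    have h2 : ∀ t, ∑ k, (m k : ZMod 2) * s (k + t) = 1 := by
      intro t
      have h := congrArg (fun z => (signHom z).toAdd) (hrel t)
      simpa [map_prod, toAdd_prod, map_zpow, toAdd_zpow, signHom_neg_one] using h
    have h3 := eq_one_of_convolution_eq_one (n - 2) s (fun k => (m k : ZMod 2)) h1 h2 k₀
    simp [hm] at h3

end Circular

/-! ### Characters and trace elements in the group algebra. -/

section GroupAlgebra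

theorem eq_sum_single {G R : Type*} [Fintype G] [Semiring R] (v : MonoidAlgebra R G) :
    v = ∑ g, MonoidAlgebra.single g (v.coeff g) := by
  classical
  ext g
  simp [MonoidAlgebra.coeff_sum]

variable {G : Type*} [CommGroup G] {K : Type*} [Field K]

theorem coeff_coeffMap (v : MonoidAlgebra ℤ G) (g : G) :
    (coeffMap G K v).coeff g = (v.coeff g : K) := by
  simp [coeffMap]

theorem coeffMap_single (g : G) (a : ℤ) :
    coeffMap G K (MonoidAlgebra.single g a) = MonoidAlgebra.single g (a : K) := by
  simp [coeffMap]

theorem coeffMap_injective [CharZero K] : Function.Injective (coeffMap G K) := by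
  intro v w h
  ext g
  have := congrArg (fun f => f.coeff g) h
  simpa [coeff_coeffMap] using this

/-- The extension of a linear character to the group algebra. -/
noncomputable def evalChar (χ : G →* Kˣ) : MonoidAlgebra K G →ₐ[K] K :=
  MonoidAlgebra.lift K K G ((Units.coeHom K).comp χ)

theorem evalChar_single (χ : G →* Kˣ) (g : G) (a : K) :
    evalChar χ (MonoidAlgebra.single g a) = a * χ g := by
  simp [evalChar, MonoidAlgebra.lift_single]

variable [Fintype G]

theorem coeff_charIdempotent (χ : G →* Kˣ) (g : G) :
    (charIdempotent χ).coeff g = (Fintype.card G : K)⁻¹ * (χ g⁻¹ : K) := by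
  classical
  simp [charIdempotent, MonoidAlgebra.coeff_sum, Finsupp.finsetSum_apply, Finsupp.single_apply]

variable [NumberField K]

/-- The element `∑_σ σ β • e(σ ∘ χ)` of the group algebra. -/
noncomputable def traceElt (χ : G →* Kˣ) (β : K) : MonoidAlgebra K G :=
  ∑ σ : K ≃ₐ[ℚ] K, σ β • charIdempotent ((Units.map (σ : K →* K)).comp χ)

theorem localUnit_eq (χ : G →* Kˣ) (β : K) : localUnit χ β = 1 + traceElt χ (β - 1) := by
  simp [localUnit, traceElt]

theorem coeff_traceElt (χ : G →* Kˣ) (β : K) (g : G) :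
    (traceElt χ β).coeff g = (Fintype.card G : K)⁻¹ * ∑ σ : K ≃ₐ[ℚ] K, σ (β * (χ g⁻¹ : K)) := by
  rw [traceElt, MonoidAlgebra.coeff_sum, Finsupp.finsetSum_apply, Finset.mul_sum]
  refine Finset.sum_congr rfl fun σ _ => ?_
  rw [MonoidAlgebra.coeff_smul_apply, coeff_charIdempotent, smul_eq_mul, map_mul]
  simp only [MonoidHom.comp_apply, Units.coe_map]
  change σ β * (_ * σ _) = _
  ring

theorem traceElt_add (χ : G →* Kˣ) (β γ : K) :
    traceElt χ (β + γ) = traceElt χ β + traceElt χ γ := by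
  simp [traceElt, add_smul, Finset.sum_add_distrib]

theorem traceElt_neg (χ : G →* Kˣ) (β : K) : traceElt χ (-β) = -traceElt χ β := by
  simp [traceElt]

theorem traceElt_zero (χ : G →* Kˣ) : traceElt χ 0 = 0 := by
  simp [traceElt]

theorem traceElt_ratCast_mul (χ : G →* Kˣ) (q : ℚ) (γ : K) :
    traceElt χ (q * γ) = MonoidAlgebra.single 1 (q : K) * traceElt χ γ := by
  ext g
  rw [MonoidAlgebra.coeff_single_mul_apply, inv_one, one_mul, coeff_traceElt, coeff_traceElt,
    mul_left_comm]
  congr 1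
  rw [Finset.mul_sum]
  simp [mul_assoc]

/-- The coefficient at `h` is a multiple of the trace of `γ * χ(h⁻¹)`, so the factor `χ g` amounts
to translation by `g`. -/
theorem traceElt_char_mul (χ : G →* Kˣ) (g : G) (γ : K) :
    traceElt χ ((χ g : K) * γ) = MonoidAlgebra.single g 1 * traceElt χ γ := by
  ext h
  rw [MonoidAlgebra.coeff_single_mul_apply, one_mul, coeff_traceElt, coeff_traceElt]
  congr 1
  refine Finset.sum_congr rfl fun σ _ => congrArg σ ?_
  rw [mul_inv_rev, inv_inv, map_mul, Units.val_mul]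
  ring

theorem localUnit_one (χ : G →* Kˣ) : localUnit χ (1 : K) = 1 := by
  rw [localUnit_eq, sub_self, traceElt_zero, add_zero]

end GroupAlgebra

/-! ### Multiplicativity and integrality of `u_χ`. -/

section Cyclic

variable {G : Type*} [CommGroup G] {K : Type*} [Field K]
  {n : ℕ} {x : G} {α : K} {χ : G →* Kˣ}

theorem char_zpow (hχ : (χ x : K) = α) (j : ℤ) : (χ (x ^ j) : K) = α ^ j := by
  rw [map_zpow, Units.val_zpow_eq_zpow_val, hχ]

theorem char_involution (hn : 1 ≤ n) (hα : IsPrimitiveRoot α (2 ^ n)) (hχ : (χ x : K) = α) :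
    (χ (x ^ 2 ^ (n - 1)) : K) = -1 := by
  rw [map_pow, Units.val_pow_eq_pow_val, hχ, pow_two_pow_pred_eq_neg_one hn hα]

variable [Fintype G]

theorem orderOf_eq_card (hG : Fintype.card G = 2 ^ n) (hx : ∀ g : G, g ∈ Subgroup.zpowers x) :
    orderOf x = 2 ^ n := by
  rw [orderOf_eq_card_of_forall_mem_zpowers hx, Nat.card_eq_fintype_card, hG]

theorem char_injective (hG : Fintype.card G = 2 ^ n) (hx : ∀ g : G, g ∈ Subgroup.zpowers x)
    (hα : IsPrimitiveRoot α (2 ^ n)) (hχ : (χ x : K) = α) : Function.Injective χ := by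
  rw [injective_iff_map_eq_one]
  intro g hg
  obtain ⟨j, rfl⟩ := Subgroup.mem_zpowers_iff.mp (hx g)
  have h : α ^ j = 1 := by rw [← char_zpow hχ, hg, Units.val_one]
  rw [hα.zpow_eq_one_iff_dvd] at h
  rw [← orderOf_dvd_iff_zpow_eq_one, orderOf_eq_card hG hx]
  exact h

variable [NumberField K]

theorem single_involution_mul (hn : 1 ≤ n) (hα : IsPrimitiveRoot α (2 ^ n))
    (hχ : (χ x : K) = α) {v : MonoidAlgebra ℤ G} {β : K}
    (hv : coeffMap G K v = localUnit χ β) :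
    MonoidAlgebra.single (x ^ 2 ^ (n - 1)) 1 * (v - 1) = -(v - 1) := by
  apply coeffMap_injective (K := K)
  rw [map_mul, coeffMap_single, map_neg, map_sub, map_one, hv, localUnit_eq, add_sub_cancel_left,
    Int.cast_one, ← traceElt_char_mul, char_involution hn hα hχ, neg_one_mul, traceElt_neg]

/-- Translation by the involution negates `v - 1` but preserves augmentation, so `v - 1` has
augmentation 0. -/
theorem augmentation_eq_one (hn : 1 ≤ n) (hα : IsPrimitiveRoot α (2 ^ n))
    (hχ : (χ x : K) = α) {v : MonoidAlgebra ℤ G} {β : K}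
    (hv : coeffMap G K v = localUnit χ β) : augmentation G v = 1 := by
  have h := congrArg (augmentation G) (single_involution_mul hn hα hχ hv)
  have h1 : augmentation G (MonoidAlgebra.single (x ^ 2 ^ (n - 1)) 1) = 1 := by
    simp [augmentation]
  rw [map_mul, h1, one_mul, map_neg, map_sub, map_one] at h
  linarith

variable [IsCyclotomicExtension {2 ^ n} ℚ K]

/-- The trace of `χ(g⁻¹)` vanishes unless `χ g = ±1`, which by injectivity of `χ` leaves only `1`
and the involution. -/
theorem two_mul_traceElt_one (hn : 1 ≤ n) (hG : Fintype.card G = 2 ^ n)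
    (hx : ∀ g : G, g ∈ Subgroup.zpowers x) (hα : IsPrimitiveRoot α (2 ^ n))
    (hχ : (χ x : K) = α) :
    2 * traceElt χ 1 = 1 - MonoidAlgebra.single (x ^ 2 ^ (n - 1)) (1 : K) := by
  classical
  have hw := char_involution hn hα hχ
  set w := x ^ 2 ^ (n - 1)
  have hinj := char_injective hG hx hα hχ
  have hw1 : w ≠ 1 := by
    intro h
    rw [h, map_one, Units.val_one] at hw
    norm_num at hw
  have hcard : (Fintype.card G : K) = 2 * 2 ^ (n - 1) := by
    rw [hG, ← pow_succ', Nat.sub_add_cancel hn]; push_cast; rfl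
  have h2 : (2 : K) ^ (n - 1) ≠ 0 := pow_ne_zero _ two_ne_zero
  ext g
  rw [two_mul, MonoidAlgebra.coeff_add, Finsupp.add_apply, coeff_traceElt, hcard, one_mul,
    MonoidAlgebra.coeff_sub, Finsupp.sub_apply, MonoidAlgebra.one_def,
    MonoidAlgebra.coeff_single, MonoidAlgebra.coeff_single, Finsupp.single_apply,
    Finsupp.single_apply]
  by_cases h1 : 1 = g
  · subst h1
    simp only [inv_one, map_one, Units.val_one, if_true, if_neg hw1]
    rw [Finset.sum_const, Finset.card_univ, card_algEquiv hn]
    field_simp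
    ring
  by_cases hg : w = g
  · subst hg
    simp only [if_neg h1, map_inv, Units.val_inv_eq_inv_val, hw, inv_neg, inv_one, map_neg,
      map_one, if_true]
    rw [Finset.sum_const, Finset.card_univ, card_algEquiv hn]
    field_simp
    ring
  · rw [if_neg h1, if_neg hg]
    obtain ⟨j, hj⟩ := Subgroup.mem_zpowers_iff.mp (hx g⁻¹)
    have hne : ((χ g⁻¹ : Kˣ) : K) ^ 2 ≠ 1 := by
      intro h
      rcases eq_or_eq_neg_of_sq_eq_sq ((χ g⁻¹ : Kˣ) : K) 1 (by rw [h, one_pow]) with h | h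
      · exact h1 (inv_eq_one.mp ((map_eq_one_iff χ hinj).mp (Units.ext h))).symm
      · apply hg
        apply hinj
        ext
        rw [hw, ← inv_inv (χ g), ← map_inv, Units.val_inv_eq_inv_val, h, inv_neg, inv_one]
    rw [← hj, char_zpow hχ] at hne ⊢
    rw [sum_algEquiv_zpow_eq_zero hα hne]
    simp

theorem evalChar_traceElt_one (hn : 1 ≤ n) (hG : Fintype.card G = 2 ^ n)
    (hx : ∀ g : G, g ∈ Subgroup.zpowers x) (hα : IsPrimitiveRoot α (2 ^ n))
    (hχ : (χ x : K) = α) : evalChar χ (traceElt χ 1) = 1 := by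
  have h := congrArg (evalChar χ) (two_mul_traceElt_one hn hG hx hα hχ)
  rw [map_mul, map_sub, map_ofNat, map_one, evalChar_single, char_involution hn hα hχ] at h
  linear_combination h / 2

/-- Since `K = ℚ[α]`, multiplication by `β` is a polynomial in translation by `x`. This gives
multiplicativity without the orthogonality of the idempotents. -/
theorem exists_mul_traceElt (hα : IsPrimitiveRoot α (2 ^ n)) (hχ : (χ x : K) = α) (β : K) :
    ∃ f : MonoidAlgebra K G, evalChar χ f = β ∧
      ∀ γ, traceElt χ (β * γ) = f * traceElt χ γ := by
  have hβ : β ∈ Algebra.adjoin ℚ ({α} : Set K) := by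
    rw [IsCyclotomicExtension.adjoin_primitive_root_eq_top hα]
    exact Algebra.mem_top
  induction hβ using Algebra.adjoin_induction with
  | mem y hy =>
    rw [Set.mem_singleton_iff] at hy
    refine ⟨MonoidAlgebra.single x 1, by rw [evalChar_single, one_mul, hχ, hy], fun γ => ?_⟩
    rw [hy, ← hχ, traceElt_char_mul]
  | algebraMap a =>
    refine ⟨MonoidAlgebra.single 1 (a : K), by simp [evalChar_single], fun γ => ?_⟩
    exact traceElt_ratCast_mul χ a γ
  | add y z _ _ hy hz =>
    obtain ⟨f, hf', hf⟩ := hy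
    obtain ⟨g, hg', hg⟩ := hz
    exact ⟨f + g, by rw [map_add, hf', hg'],
      fun γ => by rw [add_mul, traceElt_add, hf, hg, add_mul]⟩
  | mul y z _ _ hy hz =>
    obtain ⟨f, hf', hf⟩ := hy
    obtain ⟨g, hg', hg⟩ := hz
    exact ⟨f * g, by rw [map_mul, hf', hg'], fun γ => by rw [mul_assoc, hf, hg, mul_assoc]⟩

theorem evalChar_traceElt (hn : 1 ≤ n) (hG : Fintype.card G = 2 ^ n)
    (hx : ∀ g : G, g ∈ Subgroup.zpowers x) (hα : IsPrimitiveRoot α (2 ^ n))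
    (hχ : (χ x : K) = α) (β : K) : evalChar χ (traceElt χ β) = β := by
  obtain ⟨f, hf, h⟩ := exists_mul_traceElt hα hχ β
  rw [← mul_one β, h, map_mul, hf, evalChar_traceElt_one hn hG hx hα hχ]

theorem evalChar_localUnit (hn : 1 ≤ n) (hG : Fintype.card G = 2 ^ n)
    (hx : ∀ g : G, g ∈ Subgroup.zpowers x) (hα : IsPrimitiveRoot α (2 ^ n))
    (hχ : (χ x : K) = α) (β : K) : evalChar χ (localUnit χ β) = β := by
  rw [localUnit_eq, map_add, map_one, evalChar_traceElt hn hG hx hα hχ]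
  ring

theorem traceElt_mul (hn : 1 ≤ n) (hG : Fintype.card G = 2 ^ n)
    (hx : ∀ g : G, g ∈ Subgroup.zpowers x) (hα : IsPrimitiveRoot α (2 ^ n))
    (hχ : (χ x : K) = α) (β γ : K) :
    traceElt χ (β * γ) = traceElt χ β * traceElt χ γ := by
  have hone : traceElt χ 1 * traceElt χ γ = traceElt χ γ := by
    have h2 : (2 : MonoidAlgebra K G) * (traceElt χ 1 * traceElt χ γ) = 2 * traceElt χ γ := by
      rw [← mul_assoc, two_mul_traceElt_one hn hG hx hα hχ, sub_mul, one_mul,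
        ← traceElt_char_mul, char_involution hn hα hχ, neg_one_mul, traceElt_neg]
      ring
    have h3 : (MonoidAlgebra.single 1 (1 / 2 : K)) * (2 : MonoidAlgebra K G) = 1 := by
      rw [mul_two, ← MonoidAlgebra.single_add, MonoidAlgebra.one_def]
      norm_num
    have h4 := congrArg (MonoidAlgebra.single 1 (1 / 2 : K) * ·) h2
    simpa only [← mul_assoc, h3, one_mul] using h4
  obtain ⟨f, -, h⟩ := exists_mul_traceElt hα hχ β
  have hβ := h 1
  rw [mul_one] at hβ
  rw [h, hβ, mul_assoc, hone]

theorem localUnit_mul (hn : 1 ≤ n) (hG : Fintype.card G = 2 ^ n)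
    (hx : ∀ g : G, g ∈ Subgroup.zpowers x) (hα : IsPrimitiveRoot α (2 ^ n))
    (hχ : (χ x : K) = α) (β γ : K) :
    localUnit χ (β * γ) = localUnit χ β * localUnit χ γ := by
  simp only [localUnit_eq]
  rw [show β * γ - 1 = (β - 1) * (γ - 1) + ((β - 1) + (γ - 1)) by ring, traceElt_add,
    traceElt_add, traceElt_mul hn hG hx hα hχ]
  ring

theorem localUnit_neg_one (hn : 1 ≤ n) (hG : Fintype.card G = 2 ^ n)
    (hx : ∀ g : G, g ∈ Subgroup.zpowers x) (hα : IsPrimitiveRoot α (2 ^ n))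
    (hχ : (χ x : K) = α) :
    localUnit χ (-1 : K) = MonoidAlgebra.single (x ^ 2 ^ (n - 1)) 1 := by
  rw [localUnit_eq, show (-1 : K) - 1 = -(1 + 1) by ring, traceElt_neg, traceElt_add, ← two_mul,
    two_mul_traceElt_one hn hG hx hα hχ]
  ring

/-- If `u_χ(β)` has integral coefficients then `β ≡ 1` modulo `2 ℤ[α]`. -/
theorem exists_eq_one_add_two_mul (hn : 1 ≤ n) (hG : Fintype.card G = 2 ^ n)
    (hx : ∀ g : G, g ∈ Subgroup.zpowers x) (hα : IsPrimitiveRoot α (2 ^ n))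
    (hχ : (χ x : K) = α) {v : MonoidAlgebra ℤ G} {β : K}
    (hv : coeffMap G K v = localUnit χ β) :
    ∃ ρ ∈ Algebra.adjoin ℤ {α}, β = 1 + 2 * ρ := by
  classical
  have hanti := single_involution_mul hn hα hχ hv
  set y := v - 1 with hy
  have hN : 2 ^ n = 2 ^ (n - 1) + 2 ^ (n - 1) := by
    rw [← mul_two, ← pow_succ, Nat.sub_add_cancel hn]
  -- Coefficients and powers of `α` both change sign under the shift by `2 ^ (n - 1)`, so the two
  -- halves of the sum for `β - 1` coincide.
  have hcoeff : ∀ g, y.coeff (x ^ 2 ^ (n - 1) * g) = -y.coeff g := by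
    intro g
    have h := congrArg (fun f => f.coeff (x ^ 2 ^ (n - 1) * g)) hanti
    simp only [MonoidAlgebra.coeff_single_mul_apply, inv_mul_cancel_left, one_mul,
      MonoidAlgebra.coeff_neg, Finsupp.neg_apply] at h
    linarith
  have heval : evalChar χ (coeffMap G K y) = β - 1 := by
    rw [hy, map_sub, map_sub, hv, evalChar_localUnit hn hG hx hα hχ, map_one, map_one]
  have hsum : evalChar χ (coeffMap G K y) =
      ∑ i ∈ Finset.range (2 ^ n), (y.coeff (x ^ i) : K) * α ^ i := by
    conv_lhs => rw [eq_sum_single y]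
    rw [map_sum, map_sum, ← IsCyclic.image_range_orderOf hx, Finset.sum_image,
      orderOf_eq_card hG hx]
    · refine Finset.sum_congr rfl fun i _ => ?_
      rw [coeffMap_single, evalChar_single, map_pow χ, Units.val_pow_eq_pow_val, hχ]
    · intro i hi j hj h
      exact pow_injOn_Iio_orderOf (by simpa using hi) (by simpa using hj) h
  refine ⟨∑ i ∈ Finset.range (2 ^ (n - 1)), (y.coeff (x ^ i) : K) * α ^ i, ?_, ?_⟩
  · refine sum_mem fun i _ => mul_mem ?_ (pow_mem (Algebra.self_mem_adjoin_singleton ℤ α) i)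
    exact intCast_mem _ _
  · have : β - 1 = 2 * ∑ i ∈ Finset.range (2 ^ (n - 1)), (y.coeff (x ^ i) : K) * α ^ i := by
      rw [← heval, hsum, hN, Finset.sum_range_add, two_mul]
      congr 1
      refine Finset.sum_congr rfl fun i _ => ?_
      rw [pow_add, hcoeff, pow_add, pow_two_pow_pred_eq_neg_one hn hα]
      push_cast
      ring
    linear_combination this

/-- The integral `u_χ(β)` are already closed under products and inverses, and have augmentation 1
automatically. -/
theorem mem_localUnitGroup (hn : 1 ≤ n) (hG : Fintype.card G = 2 ^ n)
    (hx : ∀ g : G, g ∈ Subgroup.zpowers x) (hα : IsPrimitiveRoot α (2 ^ n))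
    (hχ : (χ x : K) = α) (U : Subgroup (𝓞 K)ˣ) (v : (MonoidAlgebra ℤ G)ˣ) :
    v ∈ localUnitGroup χ U ↔ ∃ β ∈ U, coeffMap G K v = localUnit χ ((β : 𝓞 K) : K) := by
  constructor
  · intro hv
    induction hv using Subgroup.closure_induction with
    | mem w hw => exact hw.2
    | one => exact ⟨1, one_mem _, by simp [localUnit_one]⟩
    | mul y z _ _ hy hz =>
      obtain ⟨β, hβ, hy⟩ := hy
      obtain ⟨γ, hγ, hz⟩ := hz
      refine ⟨β * γ, mul_mem hβ hγ, ?_⟩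
      rw [Units.val_mul, map_mul, hy, hz, coe_unit_mul, localUnit_mul hn hG hx hα hχ]
    | inv y _ hy =>
      obtain ⟨β, hβ, hy⟩ := hy
      refine ⟨β⁻¹, inv_mem hβ, ?_⟩
      have h1 : coeffMap G K (y⁻¹ : (MonoidAlgebra ℤ G)ˣ) * coeffMap G K y = 1 := by
        rw [← map_mul, Units.inv_mul, map_one]
      have h2 : coeffMap G K y * localUnit χ (((β⁻¹ : (𝓞 K)ˣ) : 𝓞 K) : K) = 1 := by
        rw [hy, ← localUnit_mul hn hG hx hα hχ, ← coe_unit_mul, mul_inv_cancel]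
        simp [localUnit_one]
      exact left_inv_eq_right_inv h1 h2
  · rintro ⟨β, hβ, hv⟩
    refine Subgroup.subset_closure ⟨?_, β, hβ, hv⟩
    rw [normalizedUnits, MonoidHom.mem_ker]
    ext
    exact augmentation_eq_one hn hα hχ hv

end Cyclic

end CyclicTwoGroupUnits

/-! ### The direct decomposition. -/

theorem corollaryc (n : ℕ) (hn : 2 ≤ n)
    {G : Type*} [CommGroup G] [Fintype G] (hG : Fintype.card G = 2 ^ n)
    (x : G) (hx : ∀ g : G, g ∈ Subgroup.zpowers x)
    {K : Type*} [Field K] [NumberField K] [IsCyclotomicExtension {2 ^ n} ℚ K]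
    (α : K) (hα : IsPrimitiveRoot α (2 ^ n))
    (χ : G →* Kˣ) (hχ : (χ x : K) = α) :
    ∃ V : Subgroup (MonoidAlgebra ℤ G)ˣ,
      (V : Set (MonoidAlgebra ℤ G)ˣ) = CyclicTwoGroupUnits.setV n α χ ∧
      V ≤ CyclicTwoGroupUnits.groupW χ ∧
      CyclicTwoGroupUnits.IsInternalProd (CyclicTwoGroupUnits.groupWCirc n α χ)
        (Subgroup.zpowers (CyclicTwoGroupUnits.groupUnit (x ^ 2 ^ (n - 1)))) V ∧
      (CyclicTwoGroupUnits.circularUnits n α = ⊤ →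
        CyclicTwoGroupUnits.IsInternalProd (CyclicTwoGroupUnits.groupW χ)
          (Subgroup.zpowers (CyclicTwoGroupUnits.groupUnit (x ^ 2 ^ (n - 1)))) V) := by
  open CyclicTwoGroupUnits in
  have hn1 : 1 ≤ n := by omega
  have hmem := mem_localUnitGroup hn1 hG hx hα hχ
  have hcongr := fun (v : MonoidAlgebra ℤ G) (β : K) (h : coeffMap G K v = localUnit χ β) =>
    exists_eq_one_add_two_mul hn1 hG hx hα hχ h
  set w := groupUnit (x ^ 2 ^ (n - 1)) with hw
  have hwu : coeffMap G K w = localUnit χ (-1 : K) := by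
    rw [localUnit_neg_one hn1 hG hx hα hχ]
    change coeffMap G K (MonoidAlgebra.single (x ^ 2 ^ (n - 1)) 1) = _
    rw [coeffMap_single, Int.cast_one]
  have hwsq : w ^ 2 = 1 := by
    ext1
    apply coeffMap_injective (K := K)
    rw [Units.val_pow_eq_pow_val, map_pow, hwu, sq, ← localUnit_mul hn1 hG hx hα hχ]
    simp [localUnit_one]
  have hneg : (((-1 : (𝓞 K)ˣ) : 𝓞 K) : K) = -1 := by simp
  have hprod : IsInternalProd (groupWCirc n α χ) (Subgroup.zpowers w)
      (localUnitGroup χ (groupD n α)) := by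
    constructor
    · rw [eq_bot_iff]
      rintro v ⟨hv, hvD⟩
      obtain ⟨d, hd, hvd⟩ := (hmem _ v).mp hvD
      obtain ⟨j, rfl⟩ := Subgroup.mem_zpowers_iff.mp hv
      rw [Subgroup.mem_bot]
      rcases Int.even_or_odd' j with ⟨i, rfl | rfl⟩
      · rw [zpow_mul]; norm_cast; rw [hwsq, one_zpow]
      · exfalso
        have hj : w ^ (2 * i + 1) = w := by
          rw [zpow_add_one, zpow_mul]; norm_cast; rw [hwsq, one_zpow, one_mul]
        rw [hj, hwu] at hvd
        -- Evaluation at `χ` recovers the unit, so an odd power of `w` in the second factor would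
        -- put `-1` into `D`.
        have h := congrArg (evalChar χ) hvd
        rw [evalChar_localUnit hn1 hG hx hα hχ, evalChar_localUnit hn1 hG hx hα hχ] at h
        have hd1 : d = -1 := by
          ext
          rw [← h, hneg]
        exact neg_one_notMem_groupD hn hα (hd1 ▸ hd)
    · apply le_antisymm
      · rw [sup_le_iff, Subgroup.zpowers_le]
        constructor
        · exact (hmem _ w).mpr ⟨-1, neg_one_mem_circularUnits hn hα, by rw [hwu, hneg]⟩
        · intro v hv
          obtain ⟨d, hd, hvd⟩ := (hmem _ v).mp hv
          exact (hmem _ v).mpr ⟨d, groupD_le_circularUnits hn hα hd, hvd⟩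
      · intro v hv
        obtain ⟨β, hβ, hvβ⟩ := (hmem _ v).mp hv
        obtain ⟨k, d, hd, hkd⟩ := exists_eq_of_mem_circularUnits hn hα hβ
        obtain ⟨ρ, hρ, hβρ⟩ := hcongr _ _ hvβ
        obtain ⟨c, hc⟩ := exists_algEquiv_inv hα
        have hsq : (α ^ k) ^ 2 = 1 := zpow_sq_eq_one_of_congr hn1 hα hc
          (algEquiv_inv_groupD hc hd) hρ (by rw [← hkd, hβρ])
        rcases eq_or_eq_neg_of_sq_eq_sq (α ^ k) 1 (by rw [hsq, one_pow]) with h | h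
        · rw [h, one_mul] at hkd
          exact Subgroup.mem_sup_right ((hmem _ v).mpr ⟨d, hd, by rw [hvβ, hkd]⟩)
        · rw [h, neg_one_mul] at hkd
          have hwv : w * v ∈ localUnitGroup χ (groupD n α) :=
            (hmem _ _).mpr ⟨d, hd, by
              rw [Units.val_mul, map_mul, hwu, hvβ, ← localUnit_mul hn1 hG hx hα hχ, hkd,
                neg_one_mul, neg_neg]⟩
          rw [← inv_mul_cancel_left w v]
          exact mul_mem (Subgroup.mem_sup_left (inv_mem (Subgroup.mem_zpowers w)))
            (Subgroup.mem_sup_right hwv)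
  have hle : localUnitGroup χ (groupD n α) ≤ groupW χ := by
    intro v hv
    obtain ⟨d, -, hvd⟩ := (hmem _ v).mp hv
    exact (hmem _ v).mpr ⟨d, Subgroup.mem_top d, hvd⟩
  -- The group attached to `D` serves as `V₁`: the congruence defining `E` follows from integrality.
  refine ⟨localUnitGroup χ (groupD n α), ?_, hle, hprod, fun htop => ?_⟩
  · ext v
    constructor
    · intro hv
      obtain ⟨d, hd, hvd⟩ := (hmem _ v).mp hv
      exact ⟨hle hv, d, ⟨hd, hcongr _ _ hvd⟩, hvd⟩
    · rintro ⟨-, d, ⟨hd, -⟩, hvd⟩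
      exact (hmem _ v).mpr ⟨d, hd, hvd⟩
  · have : groupW χ = groupWCirc n α χ := by rw [groupW, groupWCirc, htop]
    rw [this]
    exact hprod
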